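/- **Model.** Fix $L\ge 1$ parallel queues operating in slotted time. In slot $t$ a number $A_\Sigma[t]$ of packets arrives and is distributed by a router to the queues as a vector $(A_l[t])_{l}$ of nonnegative integers with $\sum_l A_l[t]=A_\Sigma[t]$; then $Q_l[t+1]=(Q_l[t]+A_l[t]-S_l[t])^+$. The arrivals $\{A_\Sigma[t]\}_t$ and the services $\{S_l[t]\}_t$, $l=1,\dots,L$, are mutually independent i.i.d. sequences of nonnegative integers with $A_\Sigma[t]\le A_{\max}$ and $S_l[t]\le S_{\max}$. Write $\lambda_\Sigma,\sigma_\Sigma^2$ for the mean and variance of $A_\Sigma[t]$, $\mu_l>0$ and $\nu_l^2$ for those of $S_l[t]$, and $\mu_\Sigma=\sum_l\mu_l$, $\nu_\Sigma^2=\sum_l\nu_l^2$. A *feasible routing policy* chooses $(A_l[t])_l$, possibly at random, from the current queue lengths, $A_\Sigma[t]$ and a memory (which may record the past), independently of the services of slot $t$ and later and of future arrivals. *Join-the-Shortest-Queue* (JSQ) sends all packets of a slot to one queue, chosen uniformly at random among the queues of minimal length. A *steady-state* vector $\overline{\mathbf Q}$ of a policy is a limit in distribution, as $t\to\infty$, of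 $\mathbf Q[t]$ for some initial law (for JSQ these are exactly the stationary laws of the chain $\mathbf Q[t]$). The service laws and $A_{\max}$ are fixed; the arrival law varies, with $\varepsilon=\mu_\Sigma-\lambda_\Sigma^{(\varepsilon)}>0$ and variance $(\sigma_\Sigma^{(\varepsilon)})^2$. **Proposition.** 1. For every $\varepsilon>0$ and every such arrival law, JSQ has a steady-state vector. There is a function $\overline B^{(\varepsilon)}$ with $\lim_{\varepsilon\downarrow0}\varepsilon\overline B^{(\varepsilon)}=0$, depending only on the service laws and $A_{\max}$, such that for every $\varepsilon>0$, every such arrival law and every steady-state vector $\overline{\mathbf Q}^{(\varepsilon)}$ of JSQ, $$\mathbb E\Big[\sum_{l=1}^L\overline Q_l^{(\varepsilon)}\Big]\le\frac{\zeta^{(\varepsilon)}}{2\varepsilon}+\overline B^{(\varepsilon)}<\infty,\qquad \zeta^{(\varepsilon)}=(\sigma_\Sigma^{(\varepsilon)})^2+\nu_\Sigma^2 .$$ 2. (Heavy-traffic limit.) Consider any family (sequence, or net) of such arrival laws along which $\varepsilon\downarrow0$ and $(\sigma_\Sigma^{(\varepsilon)})^2\to\sigma_\Sigma^2$, and put $\zeta=\sigma_\Sigma^2+\nu_\Sigma^2$.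 Then for all steady-state vectors of JSQ $$\limsup_{\varepsilon\downarrow0}\varepsilon\,\mathbb E\Big[\sum_l\overline Q_l^{(\varepsilon)}\Big]\le\frac{\zeta}{2},$$ while for all feasible routing policies $P^{(\varepsilon)}$ and all their steady-state vectors $\overline{\mathbf Q}^{(\varepsilon),P}$ $$\liminf_{\varepsilon\downarrow0}\varepsilon\,\mathbb E\Big[\sum_l\overline Q_l^{(\varepsilon),P}\Big]\ge\frac{\zeta}{2}.$$ In particular $\varepsilon\,\mathbb E[\sum_l\overline Q_l^{(\varepsilon)}]\to\zeta/2$ under JSQ, so that JSQ is first-moment heavy-traffic optimal. -/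

import Mathlib

open MeasureTheory ProbabilityTheory Filter Topology
open scoped ENNReal

namespace Routing

noncomputable section

/-- Mean of a law on the nonnegative integers. -/
def mean (p : PMF ℕ) : ℝ := ∫ n, (n : ℝ) ∂p.toMeasure

/-- Variance of a law on the nonnegative integers. -/
def var (p : PMF ℕ) : ℝ := variance (fun n : ℕ => (n : ℝ)) p.toMeasure

/-- The random variable with law `p` is bounded by `b`, almost surely. -/
def BoundedBy (p : PMF ℕ) (b : ℕ) : Prop := ∀ n ∈ p.support, n ≤ b

variable {L : ℕ}

/-- `μ_Σ`, the sum of the mean service rates. -/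
def muSum (svc : Fin L → PMF ℕ) : ℝ := ∑ l, mean (svc l)

/-- `ν_Σ²`, the sum of the variances of the services. -/
def nuSqSum (svc : Fin L → PMF ℕ) : ℝ := ∑ l, var (svc l)

/-- Law of the vector `(S_1[t], …, S_L[t])` of independent services in one slot. -/
def serviceLaw (svc : Fin L → PMF ℕ) : PMF (Fin L → ℕ) :=
  (Measure.pi fun l => (svc l).toMeasure).toPMF

/-- `arr` is the law of the exogenous arrivals of a slot in the system with parameter `ε`:
bounded by `Amax`, with mean `λ_Σ` such that `ε = μ_Σ - λ_Σ > 0`. -/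
structure IsArrivalLaw (svc : Fin L → PMF ℕ) (Amax : ℕ) (ε : ℝ) (arr : PMF ℕ) : Prop where
  pos : 0 < ε
  bounded : BoundedBy arr Amax
  mean_eq : ε = muSum svc - mean arr

/-- A feasible routing policy. In each slot the router knows the queue lengths `Q[t]`, the number
`A_Σ[t]` of arrivals and the current content of its own memory (which may record the whole past).
It draws an allocation `(A_l[t])_l` of the arrivals to the queues, which has to satisfy
`∑ l, A_l[t] = A_Σ[t]`, together with the new content of the memory. -/
structure Policy (L : ℕ) where
  /-- possible contents of the memory of the router -/
  Mem : Type
  /-- joint law of the allocation and of the new memory content -/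
  route : (Fin L → ℕ) → Mem → ℕ → PMF ((Fin L → ℕ) × Mem)
  feasible : ∀ q m a, ∀ v ∈ (route q m a).support, ∑ l, v.1 l = a

/-- One slot of the system: `A_Σ[t]` is drawn from `arr`, the policy allocates it, the services
are drawn independently of all that, and `Q_l[t+1] = (Q_l[t] + A_l[t] - S_l[t])⁺`
(the subtraction of natural numbers is truncated at `0`). -/
def step (svc : Fin L → PMF ℕ) (arr : PMF ℕ) (P : Policy L) (x : (Fin L → ℕ) × P.Mem) :
    PMF ((Fin L → ℕ) × P.Mem) :=
  arr.bind fun a =>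
    (P.route x.1 x.2 a).bind fun v =>
      (serviceLaw svc).map fun s => (fun l => x.1 l + v.1 l - s l, v.2)

/-- Law of queue lengths and memory at time `t`, for the law `init` at time `0`. -/
def lawAt (svc : Fin L → PMF ℕ) (arr : PMF ℕ) (P : Policy L) (init : PMF ((Fin L → ℕ) × P.Mem)) :
    ℕ → PMF ((Fin L → ℕ) × P.Mem)
  | 0 => init
  | t + 1 => (lawAt svc arr P init t).bind (step svc arr P)

/-- A law on queue-length vectors as a probability measure. -/
def toProbMeasure (p : PMF (Fin L → ℕ)) : ProbabilityMeasure (Fin L → ℕ) :=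
  ⟨p.toMeasure, PMF.toMeasure.isProbabilityMeasure p⟩

/-- `π` is a steady-state law of the queue lengths under the policy `P`: for some initial law,
`Q[t]` converges in distribution to `π` as `t → ∞`. (Every stationary law of the queue-length
chain of a memoryless policy is of this kind: take it as the initial law.) -/
def IsSteadyState (svc : Fin L → PMF ℕ) (arr : PMF ℕ) (P : Policy L) (π : PMF (Fin L → ℕ)) :
    Prop :=
  ∃ init : PMF ((Fin L → ℕ) × P.Mem),
    Tendsto (fun t => toProbMeasure ((lawAt svc arr P init t).map Prod.fst)) atTop
      (𝓝 (toProbMeasure π))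

/-- Expected total queue length `E[∑ l, Q_l]`, as an element of `[0, ∞]`. -/
def meanTotal (π : PMF (Fin L → ℕ)) : ℝ≥0∞ :=
  ∫⁻ q, ((∑ l, q l : ℕ) : ℝ≥0∞) ∂π.toMeasure

/-- The queues of minimal length. -/
def shortest (q : Fin L → ℕ) : Finset (Fin L) :=
  Finset.univ.filter fun l => ∀ k, q l ≤ q k

theorem shortest_nonempty [NeZero L] (q : Fin L → ℕ) : (shortest q).Nonempty := by
  obtain ⟨l, hl⟩ := Finite.exists_min q
  exact ⟨l, by simpa [shortest] using hl⟩

/-- Join-the-Shortest-Queue: all arrivals of the slot go to one queue, which is chosen uniformly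
at random among the queues of minimal length. No memory is used. -/
def JSQ (L : ℕ) [NeZero L] : Policy L where
  Mem := Unit
  route q _ a :=
    (PMF.uniformOfFinset (shortest q) (shortest_nonempty q)).map fun l => (Pi.single l a, ())
  feasible := by
    intro q m a v hv
    obtain ⟨l, -, rfl⟩ := (PMF.mem_support_map_iff _ _ _).1 hv
    simp

end

end Routing

/-! The proof rests on drift inequalities for Lyapunov functions. In steady state a drift inequality
E[V(next)] + f ≤ V + g yields E f ≤ E g even when V has infinite mean (`expect_le_of_drift`).

Upper bound. The drift of the squared total queue length is -2ε times the total plus ζ + ε², plus a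
cross term U · T of the unused service U and the new total T. Service is wasted only if some queue
is nearly empty, and then T is at most the gap (total excess over the shortest queue) plus a
constant. Under JSQ the gap has a stationary second moment bounded uniformly in small ε (state-space
collapse, `exists_expect_gap_sq_le`): the squared `imbalance` has a restoring drift of cubic order
in the gap. Centring the total at a multiple of 1/√ε absorbs U and makes the cross term cost only
O(√ε) (`expect_jsqKernel_total`), which vanishes next to ζ. The plain sum of squares gives existence
of a steady state and a finite mean for every ε > 0.

Lower bound. Under any policy the total dominates stochastically a single queue receiving all
arrivals and served by the sum of all services, started empty (`ofReal_pooledExpect_le`). That queue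
increases stochastically in time, and a cubic test function bounds its second moments uniformly.
Increments of a quadratic test function along it therefore tend to zero, while they are at least ζ +
ε² - O(ε) - 2ε E[total] (`le_meanTotal`). No stationarity of the policy's own process is needed. -/

namespace Routing

noncomputable section

/-- Expectation of a nonnegative function under a discrete law. -/
def expect {α : Type*} (p : PMF α) (f : α → ℝ≥0∞) : ℝ≥0∞ := ∑' x, p x * f x

/-! ### Expectations of nonnegative functions under discrete laws -/

section Expect

variable {α β : Type*}

theorem expect_mono_support (p : PMF α) {f g : α → ℝ≥0∞} (h : ∀ x ∈ p.support, f x ≤ g x) :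
    expect p f ≤ expect p g := by
  refine ENNReal.tsum_le_tsum fun x => ?_
  by_cases hx : x ∈ p.support
  · gcongr
    exact h x hx
  · simp [(p.apply_eq_zero_iff x).2 hx]

theorem expect_mono (p : PMF α) {f g : α → ℝ≥0∞} (h : ∀ x, f x ≤ g x) :
    expect p f ≤ expect p g :=
  expect_mono_support p fun x _ => h x

theorem expect_const (p : PMF α) (c : ℝ≥0∞) : expect p (fun _ => c) = c := by
  simp [expect, ENNReal.tsum_mul_right]

theorem expect_add (p : PMF α) (f g : α → ℝ≥0∞) :
    expect p (fun x => f x + g x) = expect p f + expect p g := by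
  simp [expect, mul_add, ENNReal.tsum_add]

theorem expect_const_mul (p : PMF α) (c : ℝ≥0∞) (f : α → ℝ≥0∞) :
    expect p (fun x => c * f x) = c * expect p f := by
  simp only [expect, ← ENNReal.tsum_mul_left]
  exact tsum_congr fun x => by ring

theorem expect_bind (p : PMF α) (k : α → PMF β) (f : β → ℝ≥0∞) :
    expect (p.bind k) f = expect p fun x => expect (k x) f := by
  simp only [expect, PMF.bind_apply, ← ENNReal.tsum_mul_right, ← ENNReal.tsum_mul_left]
  rw [ENNReal.tsum_comm]
  simp only [mul_assoc]

theorem expect_pure (x : α) (f : α → ℝ≥0∞) : expect (PMF.pure x) f = f x := by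
  rw [expect, tsum_eq_single x]
  · simp
  · intro y hy
    simp [hy]

theorem expect_map (p : PMF α) (k : α → β) (f : β → ℝ≥0∞) :
    expect (p.map k) f = expect p fun x => f (k x) := by
  simp [PMF.map, expect_bind, expect_pure]

theorem expect_eq_lintegral [MeasurableSpace α] [Countable α] [MeasurableSingletonClass α]
    (p : PMF α) (f : α → ℝ≥0∞) : expect p f = ∫⁻ x, f x ∂p.toMeasure := by
  rw [lintegral_countable']
  exact tsum_congr fun x => by
    rw [PMF.toMeasure_apply_singleton _ _ (measurableSet_singleton x), mul_comm]

/-- Monotone convergence, obtained by reading the sum as an integral against counting measure; the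
discrete σ-algebra makes every function measurable. -/
theorem expect_le_of_iSup (p : PMF α) (f : ℕ → α → ℝ≥0∞) {g : α → ℝ≥0∞} {c : ℝ≥0∞}
    (hmono : ∀ x, Monotone fun n => f n x) (hsup : ∀ x, ⨆ n, f n x = g x)
    (hle : ∀ n, expect p (f n) ≤ c) : expect p g ≤ c := by
  let _ : MeasurableSpace α := ⊤
  have h : expect p g = ⨆ n, expect p (f n) := by
    simp only [expect, ← hsup, ENNReal.mul_iSup]
    simp only [← lintegral_count]
    rw [lintegral_iSup (fun _ => measurable_from_top)]
    intro m n hmn x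
    exact mul_le_mul_right (hmono x hmn) _
  rw [h]
  exact iSup_le hle

end Expect

/-! ### Moments of the arrivals and services of one slot -/

section Slot

variable {L : ℕ} (svc : Fin L → PMF ℕ) (arr : PMF ℕ)

/-- Joint law of the number of arrivals and of the services of a slot. -/
def slot : Measure (ℕ × (Fin L → ℕ)) :=
  arr.toMeasure.prod (Measure.pi fun l => (svc l).toMeasure)

instance : IsProbabilityMeasure (slot svc arr) := by
  unfold slot
  infer_instance

theorem toMeasure_serviceLaw :
    (serviceLaw svc).toMeasure = Measure.pi fun l => (svc l).toMeasure :=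
  Measure.toPMF_toMeasure _

theorem expect_slot (f : ℕ → (Fin L → ℕ) → ℝ≥0∞) :
    (expect arr fun a => expect (serviceLaw svc) (f a)) = ∫⁻ ω, f ω.1 ω.2 ∂slot svc arr := by
  rw [slot, lintegral_prod _ (measurable_of_countable _).aemeasurable]
  simp only [expect_eq_lintegral, toMeasure_serviceLaw]

variable {svc arr} {Amax Smax : ℕ}

theorem ae_toMeasure_of_boundedBy {p : PMF ℕ} {b : ℕ} (h : BoundedBy p b) :
    ∀ᵐ n ∂p.toMeasure, n ≤ b := by
  rw [ae_iff, PMF.toMeasure_apply_eq_zero_iff _ (MeasurableSet.of_discrete)]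
  rw [Set.disjoint_left]
  intro n hn hn'
  exact hn' (h n hn)

theorem measurePreserving_slot_fst :
    MeasurePreserving Prod.fst (slot svc arr) arr.toMeasure :=
  measurePreserving_fst

theorem measurePreserving_slot_snd (l : Fin L) :
    MeasurePreserving (fun ω : ℕ × (Fin L → ℕ) => ω.2 l) (slot svc arr) (svc l).toMeasure :=
  (measurePreserving_eval (fun l => (svc l).toMeasure) l).comp measurePreserving_snd

theorem ae_slot_le (hs : ∀ l, BoundedBy (svc l) Smax) (ha : BoundedBy arr Amax) :
    ∀ᵐ ω ∂slot svc arr, ω.1 ≤ Amax ∧ ∀ l, ω.2 l ≤ Smax :=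
  (measurePreserving_slot_fst.quasiMeasurePreserving.ae (ae_toMeasure_of_boundedBy ha)).and
    (ae_all_iff.2 fun l => (measurePreserving_slot_snd l).quasiMeasurePreserving.ae
      (ae_toMeasure_of_boundedBy (hs l)))

/-- The slot law is concentrated on a finite box, so every function is almost surely bounded and
integrability is never an issue afterwards. -/
theorem memLp_slot (hs : ∀ l, BoundedBy (svc l) Smax) (ha : BoundedBy arr Amax)
    (f : ℕ × (Fin L → ℕ) → ℝ) (p : ℝ≥0∞) : MemLp f p (slot svc arr) := by
  have hfin : (Set.Iic Amax ×ˢ Set.Icc (0 : Fin L → ℕ) (fun _ => Smax)).Finite :=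
    (Set.finite_Iic _).prod (Set.finite_Icc _ _)
  obtain ⟨C, hC⟩ := (hfin.image fun ω => ‖f ω‖).bddAbove
  refine MemLp.of_bound (measurable_of_countable f).aestronglyMeasurable C ?_
  filter_upwards [ae_slot_le hs ha] with ω hω
  exact hC ⟨ω, ⟨hω.1, fun _ => Nat.zero_le _, hω.2⟩, rfl⟩

theorem integrable_slot (hs : ∀ l, BoundedBy (svc l) Smax) (ha : BoundedBy arr Amax)
    (f : ℕ × (Fin L → ℕ) → ℝ) : Integrable f (slot svc arr) :=
  memLp_one_iff_integrable.1 (memLp_slot hs ha f 1)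

theorem integral_slot_fst : ∫ ω, (ω.1 : ℝ) ∂slot svc arr = mean arr := by
  rw [mean, ← measurePreserving_slot_fst (svc := svc).map_eq, integral_map]
  · exact measurable_fst.aemeasurable
  · exact (measurable_of_countable _).aestronglyMeasurable

theorem integral_slot_snd (l : Fin L) : ∫ ω, (ω.2 l : ℝ) ∂slot svc arr = mean (svc l) := by
  rw [mean, ← (measurePreserving_slot_snd (arr := arr) l).map_eq, integral_map]
  · exact (measurable_of_countable _).aemeasurable
  · exact (measurable_of_countable _).aestronglyMeasurable

theorem memLp_of_boundedBy {p : PMF ℕ} {b : ℕ} (h : BoundedBy p b) :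
    MemLp (fun n : ℕ => (n : ℝ)) 2 p.toMeasure := by
  refine MemLp.of_bound (measurable_of_countable _).aestronglyMeasurable (b : ℝ) ?_
  filter_upwards [ae_toMeasure_of_boundedBy h] with n hn
  simpa using hn

theorem memLp_sum_services (hs : ∀ l, BoundedBy (svc l) Smax) :
    MemLp (fun s : Fin L → ℕ => -∑ l, (s l : ℝ)) 2 (Measure.pi fun l => (svc l).toMeasure) :=
  (memLp_finsetSum _ fun l _ => (memLp_of_boundedBy (hs l)).comp_measurePreserving
    (measurePreserving_eval (fun l => (svc l).toMeasure) l)).neg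

theorem variance_sum_services (hs : ∀ l, BoundedBy (svc l) Smax) :
    variance (fun s : Fin L → ℕ => -∑ l, (s l : ℝ)) (Measure.pi fun l => (svc l).toMeasure) =
      nuSqSum svc := by
  rw [variance_fun_neg, nuSqSum]
  simp only [var]
  rw [← variance_sum_pi fun l => memLp_of_boundedBy (hs l)]
  congr 1
  ext s
  simp

theorem integral_slot_net (hs : ∀ l, BoundedBy (svc l) Smax) (ha : BoundedBy arr Amax) :
    ∫ ω, ((ω.1 : ℝ) - ∑ l, (ω.2 l : ℝ)) ∂slot svc arr = mean arr - muSum svc := by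
  rw [integral_sub (integrable_slot hs ha _) (integrable_slot hs ha _),
    integral_finsetSum _ fun l _ => integrable_slot hs ha _, integral_slot_fst, muSum]
  simp only [integral_slot_snd]

theorem integral_slot_net_sq (hs : ∀ l, BoundedBy (svc l) Smax) (ha : BoundedBy arr Amax) :
    ∫ ω, ((ω.1 : ℝ) - ∑ l, (ω.2 l : ℝ)) ^ 2 ∂slot svc arr =
      var arr + nuSqSum svc + (muSum svc - mean arr) ^ 2 := by
  -- The net input is a sum of independent terms, A and -S, so its variance is additive; the second
  -- moment then adds the squared mean.
  have hvar := variance_add_prod (memLp_of_boundedBy ha) (memLp_sum_services hs)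
  rw [variance_sum_services hs] at hvar
  have h := variance_eq_sub (memLp_slot (svc := svc) (arr := arr) hs ha
    (fun ω => (ω.1 : ℝ) + -∑ l, (ω.2 l : ℝ)) 2)
  have hnet := integral_slot_net hs ha
  simp only [sub_eq_add_neg] at hnet ⊢
  rw [hnet] at h
  simp only [Pi.pow_apply] at h
  rw [slot] at h ⊢
  rw [hvar] at h
  rw [var]
  linear_combination -h

end Slot

/-! ### Drift criteria and stationary laws of countable chains -/

section Chain

variable {α : Type*} {K : α → PMF α}

/-- Comparison of stationary expectations under a drift condition, without any integrability
assumption on `V`. -/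
theorem expect_le_of_drift {π : PMF α} (hπ : π.bind K = π) {V f g : α → ℝ≥0∞}
    (hV : ∀ x, V x ≠ ∞) (h : ∀ x, expect (K x) V + f x ≤ V x + g x) :
    expect π f ≤ expect π g := by
  classical
  refine expect_le_of_iSup π (fun (n : ℕ) x => if V x ≤ n then f x else 0) ?_ ?_ ?_
  · intro x m n hmn
    have : (m : ℝ≥0∞) ≤ n := by exact_mod_cast hmn
    dsimp only
    split_ifs with h1 h2
    · exact le_rfl
    · exact absurd (h1.trans this) h2
    · exact zero_le
    · exact le_rfl
  · intro x
    refine le_antisymm (iSup_le fun n => by split_ifs <;> simp) ?_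
    obtain ⟨n, hn⟩ := ENNReal.exists_nat_gt (hV x)
    refine le_iSup_of_le n ?_
    simp [hn.le]
  · intro n
    have hfin : expect π (fun x => min (V x) n) ≠ ∞ := by
      refine ne_top_of_le_ne_top (ENNReal.natCast_ne_top n) ?_
      exact (expect_mono π fun x => min_le_right _ _).trans (expect_const π _).le
    have hst : expect π (fun x => expect (K x) fun y => min (V y) n) =
        expect π (fun x => min (V x) n) := by
      rw [← expect_bind, hπ]
    -- Truncating V at n keeps its stationary mean finite, hence cancellable. Where V ≤ n the drift
    -- condition applies; elsewhere the truncated V already has its maximal value n and cannot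
    -- increase.
    have key : expect π (fun x => (expect (K x) fun y => min (V y) n) +
          if V x ≤ n then f x else 0) ≤
        expect π fun x => min (V x) n + g x := by
      refine expect_mono π fun x => ?_
      split_ifs with hx
      · rw [min_eq_left hx]
        exact (add_le_add_left (expect_mono _ fun y => min_le_left _ _) _).trans (h x)
      · rw [min_eq_right (not_le.1 hx).le, add_zero]
        exact ((expect_mono _ fun y => min_le_right _ _).trans (expect_const _ _).le).trans
          le_self_add
    rw [expect_add, expect_add, hst] at key
    exact (ENNReal.add_le_add_iff_left hfin).1 key

/-- With finitely many predecessors, each mass after one step is a finite sum, so pointwise limits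
pass through the kernel. -/
theorem bind_eq_of_tendsto {π : PMF α} {p : ℕ → PMF α} (hp : ∀ t, p (t + 1) = (p t).bind K)
    (hpred : ∀ y, {x | K x y ≠ 0}.Finite)
    (hlim : ∀ x, Tendsto (fun t => p t x) atTop (𝓝 (π x))) : π.bind K = π := by
  ext y
  have hsum : ∀ q : PMF α, q.bind K y = ∑ x ∈ (hpred y).toFinset, q x * K x y := by
    intro q
    rw [PMF.bind_apply]
    refine tsum_eq_sum fun x hx => ?_
    have : K x y = 0 := by simpa using hx
    simp [this]
  have h1 : Tendsto (fun t => p (t + 1) y) atTop (𝓝 (π.bind K y)) := by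
    simp only [hp, hsum]
    refine tendsto_finsetSum _ fun x _ => ?_
    exact ENNReal.Tendsto.mul_const (hlim x) (Or.inr (PMF.apply_ne_top _ _))
  exact tendsto_nhds_unique h1 ((tendsto_add_atTop_iff_nat 1).2 (hlim y))

/-- Telescoping of the drift condition over n steps, kept additive because V may have infinite mean.
-/
theorem sum_expect_iterate_le {V f : α → ℝ≥0∞} {b : ℝ≥0∞}
    (h : ∀ x, expect (K x) V + f x ≤ V x + b) (p : PMF α) (n : ℕ) :
    expect ((fun q => q.bind K)^[n] p) V +
        ∑ t ∈ Finset.range n, expect ((fun q => q.bind K)^[t] p) f ≤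
      expect p V + n * b := by
  induction n with
  | zero => simp
  | succ n ih =>
    rw [Finset.sum_range_succ, Function.iterate_succ_apply', expect_bind]
    set q := (fun q => q.bind K)^[n] p
    have hq : expect q (fun x => expect (K x) V) + expect q f ≤ expect q V + b := by
      rw [← expect_add]
      refine (expect_mono q h).trans ?_
      rw [expect_add, expect_const]
    calc _ = (expect q (fun x => expect (K x) V) + expect q f) +
          ∑ t ∈ Finset.range n, expect ((fun q => q.bind K)^[t] p) f := by ring
      _ ≤ (expect q V + b) + ∑ t ∈ Finset.range n, expect ((fun q => q.bind K)^[t] p) f := by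
          gcongr
      _ = (expect q V + ∑ t ∈ Finset.range n, expect ((fun q => q.bind K)^[t] p) f) + b := by
          ring
      _ ≤ (expect p V + n * b) + b := by gcongr
      _ = _ := by push_cast; ring

/-- A weak limit of subprobability weights along which a function with finite sublevel sets has
bounded expectation loses no mass. -/
theorem one_le_tsum_of_tendsto {ι : Type*} {F : Filter ι} [F.NeBot] {c : ι → α → ℝ≥0∞}
    {d : α → ℝ≥0∞} {f : α → ℝ≥0∞} {M : ℝ≥0∞} (hM : M ≠ ∞) (hc : ∀ i, ∑' x, c i x = 1)
    (hlim : ∀ x, Tendsto (fun i => c i x) F (𝓝 (d x)))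
    (hsub : ∀ R : ℕ, {x | f x < R}.Finite) (hf : ∀ i, ∑' x, c i x * f x ≤ M) :
    1 ≤ ∑' x, d x := by
  classical
  -- Markov's inequality multiplied by R: the mass outside the finite set where f < R is at most M /
  -- R. A missing mass 1 - ∑ d > 0 is contradicted once R exceeds M / (1 - ∑ d).
  have key : ∀ R : ℕ, (R : ℝ≥0∞) ≤ R * ∑' x, d x + M := by
    intro R
    have h1 : ∀ i, (R : ℝ≥0∞) ≤ R * ∑ x ∈ (hsub R).toFinset, c i x + M := by
      intro i
      calc (R : ℝ≥0∞) = ∑' x, c i x * R := by rw [ENNReal.tsum_mul_right, hc, one_mul]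
        _ ≤ ∑' x, ((if x ∈ (hsub R).toFinset then c i x * R else 0) + c i x * f x) := by
            refine ENNReal.tsum_le_tsum fun x => ?_
            split_ifs with hx
            · exact le_self_add
            · rw [zero_add]
              gcongr
              simpa using hx
        _ = R * ∑ x ∈ (hsub R).toFinset, c i x + ∑' x, c i x * f x := by
            rw [ENNReal.tsum_add, tsum_eq_sum (s := (hsub R).toFinset) (by
              intro x hx
              rw [if_neg hx]), Finset.mul_sum]
            congr 1
            refine Finset.sum_congr rfl fun x hx => ?_
            rw [if_pos hx, mul_comm]
        _ ≤ _ := by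
            gcongr
            exact hf i
    have h2 : Tendsto (fun i => R * ∑ x ∈ (hsub R).toFinset, c i x + M) F
        (𝓝 (R * ∑ x ∈ (hsub R).toFinset, d x + M)) := by
      refine Tendsto.add_const _ (ENNReal.Tendsto.const_mul ?_ (Or.inr (ENNReal.natCast_ne_top R)))
      exact tendsto_finsetSum _ fun x _ => hlim x
    refine (ge_of_tendsto' h2 h1).trans ?_
    gcongr
    exact ENNReal.sum_le_tsum _
  by_contra! hlt
  lift M to NNReal using hM
  obtain ⟨t, ht⟩ : ∃ t : NNReal, (t : ℝ≥0∞) = ∑' x, d x :=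
    ⟨_, ENNReal.coe_toNNReal (ne_top_of_lt hlt)⟩
  rw [← ht] at hlt key
  have ht1 : (t : ℝ) < 1 := by exact_mod_cast hlt
  obtain ⟨R, hR⟩ := exists_nat_gt ((M : ℝ) / (1 - t))
  rw [div_lt_iff₀ (by linarith)] at hR
  have := key R
  have : (R : ℝ) ≤ R * t + M := by exact_mod_cast this
  nlinarith

/-- Existence of a stationary law (Krylov-Bogoliubov) under a Foster-Lyapunov condition, for
chains in which every state has finitely many predecessors. -/
theorem exists_stationary_of_drift (x₀ : α) {V f : α → ℝ≥0∞} {b : ℝ≥0∞} (hV : V x₀ ≠ ∞)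
    (hb : b ≠ ∞) (hpred : ∀ y, {x | K x y ≠ 0}.Finite) (hsub : ∀ R : ℕ, {x | f x < R}.Finite)
    (h : ∀ x, expect (K x) V + f x ≤ V x + b) : ∃ π : PMF α, π.bind K = π := by
  classical
  set p : ℕ → PMF α := fun t => (fun q => q.bind K)^[t] (PMF.pure x₀) with hp
  have hps : ∀ t, p (t + 1) = (p t).bind K := fun t => Function.iterate_succ_apply' _ _ _
  set r : ℕ → ℝ≥0∞ := fun n => ((n + 1 : ℕ) : ℝ≥0∞)⁻¹ with hr
  have hr0 : ∀ n, r n * ((n + 1 : ℕ) : ℝ≥0∞) = 1 := fun n =>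
    ENNReal.inv_mul_cancel (by simp) (ENNReal.natCast_ne_top _)
  -- Cesàro averages of the laws started at x₀. Dividing the telescoped drift by n + 1 bounds their
  -- f-means by V x₀ + b.
  set c : ℕ → α → ℝ≥0∞ := fun n x => r n * ∑ t ∈ Finset.range (n + 1), p t x with hc
  have hcf : ∀ n (f : α → ℝ≥0∞),
      ∑' x, c n x * f x = r n * ∑ t ∈ Finset.range (n + 1), expect (p t) f := by
    intro n f
    simp only [hc, mul_assoc, Finset.sum_mul, ENNReal.tsum_mul_left]
    rw [Summable.tsum_finsetSum fun _ _ => ENNReal.summable]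
    rfl
  have hc1 : ∀ n, ∑' x, c n x = 1 := by
    intro n
    have := hcf n fun _ => 1
    simp only [mul_one, expect_const] at this
    rw [this]
    simpa using hr0 n
  have hcM : ∀ n, ∑' x, c n x * f x ≤ V x₀ + b := by
    intro n
    rw [hcf]
    have := sum_expect_iterate_le h (PMF.pure x₀) (n + 1)
    rw [expect_pure] at this
    calc _ ≤ r n * (V x₀ + ((n + 1 : ℕ) : ℝ≥0∞) * b) := by
          gcongr
          exact le_add_self.trans this
      _ = r n * V x₀ + b := by rw [mul_add, ← mul_assoc, hr0, one_mul]
      _ ≤ 1 * V x₀ + b := by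
          gcongr
          exact ENNReal.inv_le_one.2 (by exact_mod_cast Nat.succ_le_succ (Nat.zero_le n))
      _ = _ := by rw [one_mul]
  -- Compactness of [0, ∞] gives a limit at every state simultaneously along one ultrafilter,
  -- without extracting subsequences.
  choose d hd using fun x => (⟨_, ((hyperfilter ℕ).map fun n => c n x).le_nhds_lim⟩ :
    ∃ y, Tendsto (fun n => c n x) (hyperfilter ℕ) (𝓝 y))
  have hd1 : ∑' x, d x = 1 := by
    refine le_antisymm ?_ (one_le_tsum_of_tendsto (by finiteness) hc1 hd hsub hcM)
    rw [ENNReal.tsum_eq_iSup_sum]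
    refine iSup_le fun s => le_of_tendsto' (tendsto_finsetSum s fun x _ => hd x) fun n => ?_
    exact (ENNReal.sum_le_tsum s).trans (hc1 n).le
  let π : PMF α := ⟨d, hd1 ▸ ENNReal.summable.hasSum⟩
  refine ⟨π, PMF.ext fun y => ?_⟩
  change ∑' x, d x * K x y = d y
  have hfin : ∀ w : α → ℝ≥0∞, ∑' x, w x * K x y = ∑ x ∈ (hpred y).toFinset, w x * K x y := by
    intro w
    refine tsum_eq_sum fun x hx => ?_
    have : K x y = 0 := by simpa using hx
    simp [this]
  -- One step shifts the time window, so the averages are invariant up to two boundary terms of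
  -- weight 1 / (n + 1). Both are written as additions to avoid truncated subtraction.
  have hstep : ∀ n, ∑' x, c n x * K x y + r n * p 0 y = c n y + r n * p (n + 1) y := by
    intro n
    rw [hcf n fun x => K x y, ← mul_add, hc]
    have : ∀ t, expect (p t) (fun x => K x y) = p (t + 1) y := fun t => by
      rw [hps, PMF.bind_apply, expect]
    simp only [this]
    rw [← Finset.sum_range_succ' (fun t => p t y), Finset.sum_range_succ, mul_add]
  have hr_lim : Tendsto r (hyperfilter ℕ) (𝓝 0) :=
    ((tendsto_add_atTop_iff_nat 1).2 ENNReal.tendsto_inv_nat_nhds_zero).mono_left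
      Nat.hyperfilter_le_atTop
  have hz : ∀ m : ℕ → ℕ, Tendsto (fun n => r n * p (m n) y) (hyperfilter ℕ) (𝓝 0) := by
    intro m
    refine tendsto_of_tendsto_of_tendsto_of_le_of_le tendsto_const_nhds hr_lim
      (fun _ => zero_le) fun n => ?_
    exact mul_le_of_le_one_right' (PMF.coe_le_one _ _)
  have h1 : Tendsto (fun n => ∑' x, c n x * K x y + r n * p 0 y) (hyperfilter ℕ)
      (𝓝 (∑' x, d x * K x y + 0)) := by
    refine Tendsto.add ?_ (hz fun _ => 0)
    simp only [hfin]
    refine tendsto_finsetSum _ fun x _ => ?_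
    exact ENNReal.Tendsto.mul_const (hd x) (Or.inr (PMF.apply_ne_top _ _))
  have h2 : Tendsto (fun n => c n y + r n * p (n + 1) y) (hyperfilter ℕ) (𝓝 (d y + 0)) :=
    (hd y).add (hz fun n => n + 1)
  simp only [hstep] at h1
  simpa using tendsto_nhds_unique h1 h2

end Chain

/-! ### The queue-length chain of JSQ and a one-step drift estimate -/

section JSQ

variable {L : ℕ} {svc : Fin L → PMF ℕ} {arr : PMF ℕ} {Amax Smax : ℕ}

theorem mem_support_of_mem_support_serviceLaw {s : Fin L → ℕ}
    (h : s ∈ (serviceLaw svc).support) (k : Fin L) : s k ∈ (svc k).support := by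
  rw [PMF.mem_support_iff] at h ⊢
  contrapose! h
  rw [serviceLaw, Measure.toPMF_apply, Measure.pi_singleton]
  refine Finset.prod_eq_zero (Finset.mem_univ k) ?_
  rw [PMF.toMeasure_apply_singleton _ _ (measurableSet_singleton _), h]

theorem tendsto_apply_of_tendsto_toProbMeasure {p : ℕ → PMF (Fin L → ℕ)} {π : PMF (Fin L → ℕ)}
    (h : Tendsto (fun t => toProbMeasure (p t)) atTop (𝓝 (toProbMeasure π))) (x : Fin L → ℕ) :
    Tendsto (fun t => p t x) atTop (𝓝 (π x)) := by
  have := ProbabilityMeasure.tendsto_measure_of_null_frontier_of_tendsto' (E := {x}) h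
    (by simp)
  have hval : ∀ q : PMF (Fin L → ℕ), (toProbMeasure q : Measure (Fin L → ℕ)) {x} = q x := fun q =>
    PMF.toMeasure_apply_singleton _ _ (measurableSet_singleton _)
  simpa only [hval] using this

/-- Second moment of the net input `A_Σ - S_Σ` of a slot. -/
def netSq (svc : Fin L → PMF ℕ) (arr : PMF ℕ) : ℝ :=
  var arr + nuSqSum svc + (muSum svc - mean arr) ^ 2

/-- Net input of queue `k` in a slot when `a` packets are sent to queue `l`. -/
def net (l : Fin L) (a : ℕ) (s : Fin L → ℕ) (k : Fin L) : ℝ :=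
  ((Pi.single l a : Fin L → ℕ) k : ℝ) - s k

theorem sum_mul_net (β : Fin L → ℝ) (l : Fin L) (a : ℕ) (s : Fin L → ℕ) :
    ∑ k, β k * net l a s k = β l * a - ∑ k, β k * s k := by
  simp only [net, mul_sub, Finset.sum_sub_distrib]
  congr 1
  rw [Finset.sum_eq_single l]
  · simp
  · intro k _ hk
    simp [hk]
  · simp

theorem integral_slot_affine (hs : ∀ l, BoundedBy (svc l) Smax) (ha : BoundedBy arr Amax)
    (c γ : ℝ) (β : Fin L → ℝ) (l : Fin L) :
    ∫ ω, (c + ∑ k, β k * net l ω.1 ω.2 k + γ * ((ω.1 : ℝ) - ∑ k, (ω.2 k : ℝ)) ^ 2) ∂slot svc arr =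
      c + (β l * mean arr - ∑ k, β k * mean (svc k)) + γ * netSq svc arr := by
  have hint := integrable_slot (svc := svc) (arr := arr) hs ha
  simp only [sum_mul_net]
  rw [integral_add (hint _) (hint _), integral_add (hint _) (hint _), integral_sub (hint _) (hint _),
    integral_const_mul, integral_const_mul, integral_slot_fst, integral_slot_net_sq hs ha,
    integral_finsetSum _ fun k _ => hint _]
  simp [integral_const_mul, integral_slot_snd, netSq]

variable [NeZero L]

variable (svc arr) in
/-- One slot of the queue lengths under JSQ. -/
def jsqKernel (x : Fin L → ℕ) : PMF (Fin L → ℕ) :=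
  (PMF.uniformOfFinset (shortest x) (shortest_nonempty x)).bind fun l =>
    arr.bind fun a => (serviceLaw svc).map fun s k => x k + (Pi.single l a : Fin L → ℕ) k - s k

theorem map_fst_step_JSQ (x : (Fin L → ℕ) × Unit) :
    (step svc arr (JSQ L) x).map Prod.fst = jsqKernel svc arr x.1 := by
  simp only [step, JSQ, jsqKernel, PMF.map_bind, PMF.bind_map]
  rw [PMF.bind_comm]
  simp only [Function.comp_def, PMF.map_comp]

theorem map_fst_lawAt_JSQ_succ (init : PMF ((Fin L → ℕ) × (JSQ L).Mem)) (t : ℕ) :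
    (lawAt svc arr (JSQ L) init (t + 1)).map Prod.fst =
      ((lawAt svc arr (JSQ L) init t).map Prod.fst).bind (jsqKernel svc arr) := by
  change ((lawAt svc arr (JSQ L) init t).bind (step svc arr (JSQ L))).map Prod.fst = _
  rw [PMF.map_bind, PMF.bind_map]
  congr 1
  funext x
  exact map_fst_step_JSQ x

/-- A slot removes at most `Smax` packets from each queue, so the previous state lies in a box
determined by the present one. -/
theorem finite_predecessors_jsqKernel (hs : ∀ l, BoundedBy (svc l) Smax) (y : Fin L → ℕ) :
    {x | jsqKernel svc arr x y ≠ 0}.Finite := by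
  refine (Set.finite_Icc 0 fun k => y k + Smax).subset fun x hx => ?_
  have hx : y ∈ (jsqKernel svc arr x).support := hx
  simp only [jsqKernel, PMF.mem_support_bind_iff, PMF.mem_support_map_iff] at hx
  obtain ⟨l, -, a, -, s, hsupp, rfl⟩ := hx
  refine ⟨fun _ => Nat.zero_le _, fun k => ?_⟩
  have := hs k _ (mem_support_of_mem_support_serviceLaw hsupp k)
  dsimp only
  omega

theorem IsSteadyState.stationary (hs : ∀ l, BoundedBy (svc l) Smax) {π : PMF (Fin L → ℕ)}
    (h : IsSteadyState svc arr (JSQ L) π) : π.bind (jsqKernel svc arr) = π := by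
  obtain ⟨init, hinit⟩ := h
  exact bind_eq_of_tendsto (map_fst_lawAt_JSQ_succ init) (finite_predecessors_jsqKernel hs)
    (tendsto_apply_of_tendsto_toProbMeasure hinit)

theorem isSteadyState_of_stationary {π : PMF (Fin L → ℕ)} (h : π.bind (jsqKernel svc arr) = π) :
    IsSteadyState svc arr (JSQ L) π := by
  let e : (Fin L → ℕ) → (Fin L → ℕ) × (JSQ L).Mem := fun q => (q, ())
  refine ⟨π.map e, ?_⟩
  have : ∀ t, (lawAt svc arr (JSQ L) (π.map e) t).map Prod.fst = π := by
    intro t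
    induction t with
    | zero =>
      rw [lawAt, PMF.map_comp]
      exact PMF.map_id _
    | succ t ih => rw [map_fst_lawAt_JSQ_succ, ih, h]
  simp only [this]
  exact tendsto_const_nhds

/-- Common engine of all JSQ drifts: a pathwise bound that is affine in the net inputs and quadratic
in the total one integrates explicitly. Quantifying over all shortest queues makes the tie-breaking
irrelevant. -/
theorem expect_jsqKernel_add_le (hs : ∀ l, BoundedBy (svc l) Smax) (ha : BoundedBy arr Amax)
    {x : Fin L → ℕ} {V : (Fin L → ℕ) → ℝ} (hV : ∀ y, 0 ≤ V y) {c γ f b : ℝ} {β : Fin L → ℝ}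
    (hf : 0 ≤ f)
    (hdrift : ∀ l ∈ shortest x, ∀ a ≤ Amax, ∀ s : Fin L → ℕ, (∀ k, s k ≤ Smax) →
      V (fun k => x k + (Pi.single l a : Fin L → ℕ) k - s k) ≤
        c + ∑ k, β k * net l a s k + γ * ((a : ℝ) - ∑ k, (s k : ℝ)) ^ 2)
    (hb : ∀ l ∈ shortest x,
      c + (β l * mean arr - ∑ k, β k * mean (svc k)) + γ * netSq svc arr + f ≤ b) :
    expect (jsqKernel svc arr x) (fun y => ENNReal.ofReal (V y)) + ENNReal.ofReal f ≤
      ENNReal.ofReal b := by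
  rw [jsqKernel, expect_bind, ← expect_const (PMF.uniformOfFinset (shortest x)
    (shortest_nonempty x)) (ENNReal.ofReal f), ← expect_add, ← expect_const
    (PMF.uniformOfFinset (shortest x) (shortest_nonempty x)) (ENNReal.ofReal b)]
  refine expect_mono_support _ fun l hl => ?_
  rw [PMF.mem_support_uniformOfFinset_iff] at hl
  simp only [expect_bind, expect_map]
  rw [expect_slot svc arr fun a s =>
    ENNReal.ofReal (V fun k => x k + (Pi.single l a : Fin L → ℕ) k - s k)]
  set g : ℕ × (Fin L → ℕ) → ℝ := fun ω =>
    c + ∑ k, β k * net l ω.1 ω.2 k + γ * ((ω.1 : ℝ) - ∑ k, (ω.2 k : ℝ)) ^ 2 with hg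
  have hle : ∀ᵐ ω ∂slot svc arr,
      V (fun k => x k + (Pi.single l ω.1 : Fin L → ℕ) k - ω.2 k) ≤ g ω := by
    filter_upwards [ae_slot_le hs ha] with ω hω
    exact hdrift l hl ω.1 hω.1 ω.2 hω.2
  -- Nonnegativity of the dominating polynomial, inherited from V, permits passing from the extended
  -- to the real integral.
  have hg0 : 0 ≤ᵐ[slot svc arr] g := by
    filter_upwards [hle] with ω hω
    exact (hV _).trans hω
  calc _ ≤ ∫⁻ ω, ENNReal.ofReal (g ω) ∂slot svc arr + ENNReal.ofReal f := by
        gcongr ?_ + _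
        refine lintegral_mono_ae ?_
        filter_upwards [hle] with ω hω
        exact ENNReal.ofReal_le_ofReal hω
    _ = ENNReal.ofReal (∫ ω, g ω ∂slot svc arr + f) := by
        rw [ENNReal.ofReal_add (integral_nonneg_of_ae hg0) hf,
          ofReal_integral_eq_lintegral_ofReal (integrable_slot hs ha g) hg0]
    _ ≤ _ := by
        refine ENNReal.ofReal_le_ofReal ?_
        rw [hg, integral_slot_affine hs ha]
        exact hb l hl

end JSQ

/-! ### Lyapunov functions for JSQ: stability, state-space collapse, total queue length -/

section Drift

variable {L : ℕ} {svc : Fin L → PMF ℕ} {arr : PMF ℕ} {Amax Smax : ℕ}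

theorem cast_add_sub_eq_max (n a s : ℕ) :
    ((n + a - s : ℕ) : ℝ) = max ((n : ℝ) + ((a : ℝ) - s)) 0 := by
  rcases le_total s (n + a) with h | h
  · rw [Nat.cast_sub h, max_eq_left]
    · push_cast
      ring
    · have : (s : ℝ) ≤ n + a := by exact_mod_cast h
      linarith
  · rw [Nat.sub_eq_zero_of_le h, max_eq_right]
    · simp
    · have : (n : ℝ) + a ≤ s := by exact_mod_cast h
      linarith

theorem abs_net_le {l : Fin L} {a : ℕ} {s : Fin L → ℕ} (ha : a ≤ Amax) (hs : ∀ k, s k ≤ Smax)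
    (k : Fin L) : |net l a s k| ≤ Amax + Smax := by
  have h1 : ((Pi.single l a : Fin L → ℕ) k : ℝ) ≤ Amax := by
    rcases eq_or_ne k l with rfl | h
    · simpa using ha
    · simp [h]
  have h2 : (0 : ℝ) ≤ ((Pi.single l a : Fin L → ℕ) k : ℝ) := Nat.cast_nonneg _
  have h3 : (s k : ℝ) ≤ Smax := by exact_mod_cast hs k
  have h4 : (0 : ℝ) ≤ s k := Nat.cast_nonneg _
  rw [net, abs_le]
  constructor <;> linarith [Nat.cast_nonneg (α := ℝ) Amax, Nat.cast_nonneg (α := ℝ) Smax]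

/-- Sum of the squared differences of the queue lengths. -/
def imbalance (x : Fin L → ℝ) : ℝ := ∑ k, ∑ j, (x k - x j) ^ 2

theorem imbalance_nonneg (x : Fin L → ℝ) : 0 ≤ imbalance x :=
  Finset.sum_nonneg fun _ _ => Finset.sum_nonneg fun _ _ => sq_nonneg _

/-- Truncation at zero is 1-Lipschitz, so idling never increases pairwise differences. -/
theorem imbalance_max_le (x : Fin L → ℝ) : imbalance (fun k => max (x k) 0) ≤ imbalance x := by
  refine Finset.sum_le_sum fun k _ => Finset.sum_le_sum fun j _ => ?_
  rw [sq_le_sq]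
  exact abs_max_sub_max_le_abs _ _ _

/-- Polarization; by symmetry in k and j both halves of the cross term agree, and summing over j
leaves the deviation of x k from the average. -/
theorem imbalance_add (x z : Fin L → ℝ) :
    imbalance (fun k => x k + z k) =
      imbalance x + ∑ k, 4 * (L * x k - ∑ j, x j) * z k + imbalance z := by
  have hcross : ∑ k, ∑ j, 2 * ((x k - x j) * (z k - z j)) =
      ∑ k, 4 * (L * x k - ∑ j, x j) * z k := by
    have h1 : ∑ k, ∑ j, 2 * ((x k - x j) * (z k - z j)) =
        ∑ k, ∑ j, 2 * (x k - x j) * z k + ∑ k, ∑ j, 2 * (x j - x k) * z j := by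
      simp only [← Finset.sum_add_distrib]
      exact Finset.sum_congr rfl fun k _ => Finset.sum_congr rfl fun j _ => by ring
    have h2 : ∑ k, ∑ j, 2 * (x j - x k) * z j = ∑ k, ∑ j, 2 * (x k - x j) * z k :=
      Finset.sum_comm
    rw [h1, h2, ← Finset.sum_add_distrib]
    refine Finset.sum_congr rfl fun k _ => ?_
    rw [← Finset.sum_mul, ← Finset.mul_sum, Finset.sum_sub_distrib]
    simp
    ring
  rw [← hcross]
  simp only [imbalance, ← Finset.sum_add_distrib]
  exact Finset.sum_congr rfl fun k _ => Finset.sum_congr rfl fun j _ => by ring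

theorem imbalance_le_of_abs_le {z : Fin L → ℝ} {C : ℝ} (hz : ∀ k, |z k| ≤ C) :
    imbalance z ≤ L ^ 2 * (2 * C) ^ 2 := by
  have h : ∀ k j, (z k - z j) ^ 2 ≤ (2 * C) ^ 2 := by
    intro k j
    rw [sq_le_sq]
    have := abs_le.1 (hz k)
    have := abs_le.1 (hz j)
    rw [abs_le, abs_of_nonneg (by linarith : (0 : ℝ) ≤ 2 * C)]
    constructor <;> linarith
  calc imbalance z ≤ ∑ _k : Fin L, ∑ _j : Fin L, (2 * C) ^ 2 :=
        Finset.sum_le_sum fun k _ => Finset.sum_le_sum fun j _ => h k j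
    _ = _ := by
        simp
        ring

/-- The arithmetic of state-space collapse. Here n is the number of queues, W the imbalance, D the
gap, T the service-weighted excess, b a bound on the imbalance of the net inputs and κ D one on the
cross term. Since ε ≤ μ₀ / 2, the restoring term is at most -4 μ₀ W D, hence at most -c D³; the
remaining terms are at most e D² plus a constant. -/
theorem collapse_polynomial_bound {n μ₀ b κ W D ε T : ℝ} (hn : 1 ≤ n) (hμ₀ : 0 < μ₀) (hb : 0 ≤ b) (hW : 0 ≤ W) (hD : 0 ≤ D) (hε : ε ≤ μ₀ / 2) (hT : D * μ₀ ≤ T)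
    (hDW : D ^ 2 ≤ n * W) (hWD : W ≤ n ^ 2 * D ^ 2) :
    W ^ 2 + 2 * W * b + (κ * D + b) ^ 2 + 8 * (W * (D * ε - n * T)) + D ^ 2 ≤
      W ^ 2 + (2 * b ^ 2 + (1 + 2 * b * n ^ 2 + 2 * κ ^ 2) ^ 3 / (4 * μ₀ / n) ^ 2) := by
  set c : ℝ := 4 * μ₀ / n with hc
  have hc0 : 0 < c := by positivity
  set e : ℝ := 1 + 2 * b * n ^ 2 + 2 * κ ^ 2 with he
  have he0 : 0 < e := by positivity
  have h4 : D * ε - n * T ≤ -(D * μ₀ / 2) := by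
    have h1 : 0 ≤ T := (mul_nonneg hD hμ₀.le).trans hT
    have h2 : D * μ₀ ≤ n * T := hT.trans (le_mul_of_one_le_left h1 hn)
    have h3 : D * ε ≤ D * (μ₀ / 2) := mul_le_mul_of_nonneg_left hε hD
    linarith
  have h5 : W * (D * ε - n * T) ≤ W * -(D * μ₀ / 2) := mul_le_mul_of_nonneg_left h4 hW
  have h6 : c * D ^ 3 ≤ 4 * μ₀ * W * D := by
    rw [hc, div_mul_eq_mul_div, div_le_iff₀ (by linarith)]
    have := mul_le_mul_of_nonneg_left hDW (by positivity : 0 ≤ 4 * μ₀ * D)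
    linarith
  -- A cubic beats a quadratic: either e ≤ c D, or D ≤ e / c bounds the quadratic by a constant.
  have h8 : e * D ^ 2 ≤ c * D ^ 3 + e ^ 3 / c ^ 2 := by
    rcases le_total e (c * D) with h | h
    · have h1 := mul_le_mul_of_nonneg_right h (sq_nonneg D)
      have h2 : 0 ≤ e ^ 3 / c ^ 2 := by positivity
      linarith
    · have h9 : (c * D) ^ 2 ≤ e ^ 2 := pow_le_pow_left₀ (by positivity) h 2
      have h10 : e * D ^ 2 ≤ e ^ 3 / c ^ 2 := by
        rw [le_div_iff₀ (by positivity)]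
        have := mul_le_mul_of_nonneg_left h9 he0.le
        linarith
      have : 0 ≤ c * D ^ 3 := by positivity
      linarith
  have h9 : (κ * D + b) ^ 2 ≤ 2 * κ ^ 2 * D ^ 2 + 2 * b ^ 2 := by
    linarith [sq_nonneg (κ * D - b)]
  have h10 : W * (2 * b) ≤ n ^ 2 * D ^ 2 * (2 * b) :=
    mul_le_mul_of_nonneg_right hWD (by positivity)
  have h11 : e * D ^ 2 = D ^ 2 + 2 * b * n ^ 2 * D ^ 2 + 2 * κ ^ 2 * D ^ 2 := by
    rw [he]
    ring
  linarith

variable [NeZero L]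

/-- Length of the shortest queue. -/
def minLen (x : Fin L → ℕ) : ℕ := Finset.univ.inf' Finset.univ_nonempty x

theorem minLen_le (x : Fin L → ℕ) (k : Fin L) : minLen x ≤ x k :=
  Finset.inf'_le _ (Finset.mem_univ k)

theorem eq_minLen {x : Fin L → ℕ} {l : Fin L} (hl : l ∈ shortest x) : x l = minLen x := by
  refine le_antisymm (Finset.le_inf' _ _ fun k _ => ?_) (minLen_le x l)
  exact (Finset.mem_filter.1 hl).2 k

/-- Total excess of the queue lengths over the shortest one. -/
def gap (x : Fin L → ℕ) : ℝ := ∑ k, ((x k : ℝ) - minLen x)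

theorem gap_term_nonneg (x : Fin L → ℕ) (k : Fin L) : (0 : ℝ) ≤ (x k : ℝ) - minLen x := by
  rw [sub_nonneg]
  exact_mod_cast minLen_le x k

theorem gap_nonneg (x : Fin L → ℕ) : 0 ≤ gap x := Finset.sum_nonneg fun k _ => gap_term_nonneg x k

theorem gap_term_le (x : Fin L → ℕ) (k : Fin L) : (x k : ℝ) - minLen x ≤ gap x :=
  Finset.single_le_sum (f := fun k => (x k : ℝ) - minLen x) (fun k _ => gap_term_nonneg x k)
    (Finset.mem_univ k)

theorem sum_eq_gap_add (x : Fin L → ℕ) : ∑ k, (x k : ℝ) = gap x + L * minLen x := by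
  simp [gap]

theorem card_pos_real : (1 : ℝ) ≤ L := by exact_mod_cast NeZero.one_le

theorem imbalance_le_gap (x : Fin L → ℕ) :
    imbalance (fun k => (x k : ℝ)) ≤ L ^ 2 * gap x ^ 2 := by
  have h : ∀ k j, ((x k : ℝ) - x j) ^ 2 ≤ gap x ^ 2 := by
    intro k j
    rw [sq_le_sq, abs_of_nonneg (gap_nonneg x), abs_le]
    constructor <;> linarith [gap_term_le x k, gap_term_le x j, gap_term_nonneg x k,
      gap_term_nonneg x j]
  calc imbalance (fun k => (x k : ℝ)) ≤ ∑ _k : Fin L, ∑ _j : Fin L, gap x ^ 2 :=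
        Finset.sum_le_sum fun k _ => Finset.sum_le_sum fun j _ => h k j
    _ = _ := by
        simp
        ring

theorem gap_sq_le (x : Fin L → ℕ) : gap x ^ 2 ≤ L * imbalance (fun k => (x k : ℝ)) := by
  obtain ⟨l, hl⟩ := shortest_nonempty x
  have h1 : gap x ^ 2 ≤ L * ∑ k, ((x k : ℝ) - minLen x) ^ 2 := by
    simpa [gap, -Finset.sum_sub_distrib] using sq_sum_le_card_mul_sum_sq (s := Finset.univ) (f := fun k => (x k : ℝ) - minLen x)
  -- After Cauchy–Schwarz, the column of the double sum belonging to a shortest queue already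
  -- suffices.
  refine h1.trans ?_
  refine mul_le_mul_of_nonneg_left (Finset.sum_le_sum fun k _ => ?_) (Nat.cast_nonneg _)
  rw [← eq_minLen hl]
  exact Finset.single_le_sum (f := fun j => ((x k : ℝ) - x j) ^ 2) (fun _ _ => sq_nonneg _)
    (Finset.mem_univ l)

theorem abs_sub_sum_le_gap (x : Fin L → ℕ) (k : Fin L) :
    |(L : ℝ) * x k - ∑ j, (x j : ℝ)| ≤ L * gap x := by
  have h1 := gap_term_le x k
  have h2 := gap_term_nonneg x k
  have hL := card_pos_real (L := L)
  have h3 := gap_nonneg x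
  rw [sum_eq_gap_add, abs_le]
  constructor <;> nlinarith

/-- Quadratic drift of JSQ. -/
theorem expect_jsqKernel_sum_sq (hs : ∀ l, BoundedBy (svc l) Smax) {ε δ : ℝ}
    (ha : IsArrivalLaw svc Amax ε arr) (hδ : 0 < δ) (hδμ : ∀ k, δ ≤ mean (svc k))
    (hδε : L * δ ≤ ε) (x : Fin L → ℕ) :
    expect (jsqKernel svc arr x) (fun y => ENNReal.ofReal (∑ k, (y k : ℝ) ^ 2)) +
        ENNReal.ofReal (2 * δ * ∑ k, (x k : ℝ)) ≤
      ENNReal.ofReal (∑ k, (x k : ℝ) ^ 2 + L * ((Amax : ℝ) + Smax) ^ 2) := by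
  refine expect_jsqKernel_add_le (c := ∑ k, (x k : ℝ) ^ 2 + L * ((Amax : ℝ) + Smax) ^ 2) (γ := 0)
    (β := fun k => 2 * x k) hs ha.bounded (fun y => Finset.sum_nonneg fun _ _ => sq_nonneg _)
    (by positivity) ?_ ?_
  · intro l _ a haA s hsS
    have hL : (L : ℝ) * ((Amax : ℝ) + Smax) ^ 2 = ∑ _k : Fin L, ((Amax : ℝ) + Smax) ^ 2 := by simp
    rw [hL, zero_mul, add_zero, ← Finset.sum_add_distrib, ← Finset.sum_add_distrib]
    refine Finset.sum_le_sum fun k _ => ?_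
    have h1 : (net l a s k) ^ 2 ≤ ((Amax : ℝ) + Smax) ^ 2 := by
      rw [sq_le_sq]
      exact (abs_net_le haA hsS k).trans (le_abs_self _)
    have h2 : (((x k + (Pi.single l a : Fin L → ℕ) k - s k : ℕ)) : ℝ) ^ 2 ≤
        ((x k : ℝ) + net l a s k) ^ 2 := by
      rw [cast_add_sub_eq_max, net, sq_le_sq]
      simpa using abs_max_sub_max_le_abs
        ((x k : ℝ) + (((Pi.single l a : Fin L → ℕ) k : ℝ) - s k)) 0 0
    nlinarith
  · intro l hl
    rw [eq_minLen hl, zero_mul, add_zero]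
    -- The slack ε is spread as δ over the queues: lowering every rate by δ still leaves enough
    -- capacity for the arrivals, which all join a queue of minimal length. The δ taken off produces
    -- the drift -2δ ∑ x k.
    have h1 : ∑ k, (mean (svc k) - δ) * (minLen x : ℝ) ≤ ∑ k, (mean (svc k) - δ) * x k :=
      Finset.sum_le_sum fun k _ => mul_le_mul_of_nonneg_left
        (by exact_mod_cast minLen_le x k) (sub_nonneg.2 (hδμ k))
    rw [← Finset.sum_mul, Finset.sum_sub_distrib] at h1
    simp only [sub_mul, Finset.sum_sub_distrib, ← Finset.mul_sum] at h1
    simp only [Finset.sum_const, Finset.card_univ, Fintype.card_fin, nsmul_eq_mul] at h1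
    have h2 : mean arr = muSum svc - ε := by linarith [ha.mean_eq]
    have h3 : ∑ k, 2 * (x k : ℝ) * mean (svc k) = 2 * ∑ k, mean (svc k) * x k := by
      rw [Finset.mul_sum]
      exact Finset.sum_congr rfl fun k _ => by ring
    rw [h2, h3, muSum]
    have h4 : (0 : ℝ) ≤ minLen x := Nat.cast_nonneg _
    nlinarith [mul_le_mul_of_nonneg_right hδε h4]

/-- State-space collapse: under JSQ, the stationary second moment of the gap is bounded uniformly
in the heavy-traffic parameter. -/
theorem exists_expect_gap_sq_le (hs : ∀ l, BoundedBy (svc l) Smax) {μ₀ : ℝ} (hμ₀ : 0 < μ₀)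
    (hμ : ∀ k, μ₀ ≤ mean (svc k)) (Amax : ℕ) :
    ∃ M : ℝ, 0 ≤ M ∧ ∀ (ε : ℝ) (arr : PMF ℕ), IsArrivalLaw svc Amax ε arr → ε ≤ μ₀ / 2 →
      ∀ π : PMF (Fin L → ℕ), π.bind (jsqKernel svc arr) = π →
        expect π (fun x => ENNReal.ofReal (gap x ^ 2)) ≤ ENNReal.ofReal M := by
  have hL := card_pos_real (L := L)
  set C : ℝ := (Amax : ℝ) + Smax with hC
  have hC0 : 0 ≤ C := by positivity
  set b : ℝ := L ^ 2 * (2 * C) ^ 2 with hb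
  have hb0 : 0 ≤ b := by positivity
  set κ : ℝ := 4 * L ^ 2 * C with hκ
  have hκ0 : 0 ≤ κ := by positivity
  set c : ℝ := 4 * μ₀ / L with hc
  have hc0 : 0 < c := by positivity
  set e : ℝ := 1 + 2 * b * L ^ 2 + 2 * κ ^ 2 with he
  have he0 : 0 < e := by positivity
  refine ⟨2 * b ^ 2 + e ^ 3 / c ^ 2, by positivity, fun ε arr ha hε π hπ => ?_⟩
  rw [← expect_const π (ENNReal.ofReal _)]
  -- The imbalance itself would only have drift linear in the gap; its square has cubic drift, which
  -- controls the second moment of the gap.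
  refine expect_le_of_drift hπ
    (V := fun x => ENNReal.ofReal (imbalance (fun k => (x k : ℝ)) ^ 2))
    (fun _ => ENNReal.ofReal_ne_top) fun x => ?_
  rw [← ENNReal.ofReal_add (sq_nonneg _) (by positivity)]
  set W := imbalance (fun k => (x k : ℝ)) with hW
  set D := gap x with hD
  have hW0 : 0 ≤ W := imbalance_nonneg _
  have hD0 : 0 ≤ D := gap_nonneg x
  refine expect_jsqKernel_add_le (c := W ^ 2 + 2 * W * b + (κ * D + b) ^ 2) (γ := 0)
    (β := fun k => 2 * W * (4 * (L * x k - ∑ j, (x j : ℝ)))) hs ha.bounded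
    (fun y => sq_nonneg _) (sq_nonneg _) ?_ ?_
  · intro l _ a haA s hsS
    set E : ℝ := ∑ k, 4 * (L * (x k : ℝ) - ∑ j, (x j : ℝ)) * net l a s k with hE
    have h1 : imbalance (fun k => ((x k + (Pi.single l a : Fin L → ℕ) k - s k : ℕ) : ℝ)) ≤
        W + E + b := by
      simp only [cast_add_sub_eq_max]
      refine (imbalance_max_le _).trans ?_
      rw [show (fun k => (x k : ℝ) + (((Pi.single l a : Fin L → ℕ) k : ℝ) - s k)) =
        fun k => (x k : ℝ) + net l a s k from rfl, imbalance_add]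
      gcongr
      exact imbalance_le_of_abs_le fun k => abs_net_le haA hsS k
    have h2 : |E| ≤ κ * D := by
      calc |E| ≤ ∑ k, |4 * (L * (x k : ℝ) - ∑ j, (x j : ℝ)) * net l a s k| :=
            Finset.abs_sum_le_sum_abs _ _
        _ ≤ ∑ _k : Fin L, 4 * (L * D) * C := by
            refine Finset.sum_le_sum fun k _ => ?_
            rw [abs_mul, abs_mul, abs_of_pos (by norm_num : (0 : ℝ) < 4)]
            gcongr
            · exact abs_sub_sum_le_gap x k
            · exact abs_net_le haA hsS k
        _ = κ * D := by
            simp [hκ]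
            ring
    have h3 : ∑ k, 2 * W * (4 * (L * (x k : ℝ) - ∑ j, (x j : ℝ))) * net l a s k = 2 * W * E := by
      rw [hE, Finset.mul_sum]
      exact Finset.sum_congr rfl fun k _ => by ring
    rw [h3]
    have h4 := pow_le_pow_left₀ (imbalance_nonneg _) h1 2
    have h5 : (E + b) ^ 2 ≤ (κ * D + b) ^ 2 := by
      rw [sq_le_sq]
      refine (abs_add_le _ _).trans ?_
      rw [abs_of_nonneg hb0, abs_of_nonneg (by positivity : 0 ≤ κ * D + b)]
      linarith
    nlinarith
  · intro l hl
    have hd : ∀ k, (L : ℝ) * x k - ∑ j, (x j : ℝ) = L * ((x k : ℝ) - minLen x) - D := by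
      intro k
      rw [sum_eq_gap_add]
      ring
    have h1 : ∑ k, 2 * W * (4 * (L * (x k : ℝ) - ∑ j, (x j : ℝ))) * mean (svc k) =
        8 * W * (L * ∑ k, ((x k : ℝ) - minLen x) * mean (svc k) - D * muSum svc) := by
      rw [muSum, Finset.mul_sum, Finset.mul_sum, ← Finset.sum_sub_distrib, Finset.mul_sum]
      exact Finset.sum_congr rfl fun k _ => by
        rw [hd]
        ring
    have h2 : D * μ₀ ≤ ∑ k, ((x k : ℝ) - minLen x) * mean (svc k) := by
      rw [hD, gap, Finset.sum_mul]
      exact Finset.sum_le_sum fun k _ => mul_le_mul_of_nonneg_left (hμ k) (gap_term_nonneg x k)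
    have h3 : mean arr = muSum svc - ε := by linarith [ha.mean_eq]
    rw [h1, h3, hd, eq_minLen hl]
    set T := ∑ k, ((x k : ℝ) - minLen x) * mean (svc k)
    have h4 := collapse_polynomial_bound (κ := κ) hL hμ₀ hb0 hW0 hD0 hε h2 (gap_sq_le x)
      (imbalance_le_gap x)
    have h5 : 2 * W * (4 * (L * ((minLen x : ℝ) - minLen x) - D)) * (muSum svc - ε) -
        8 * W * (L * T - D * muSum svc) = 8 * (W * (D * ε - L * T)) := by ring
    rw [h5]
    linarith

/-- Drift of the squared distance of the total queue length to `κ / 2`. -/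
theorem expect_jsqKernel_total (hs : ∀ l, BoundedBy (svc l) Smax) {ε r : ℝ}
    (ha : IsArrivalLaw svc Amax ε arr) (hr : 0 < r) (x : Fin L → ℕ) :
    expect (jsqKernel svc arr x)
        (fun y => ENNReal.ofReal ((∑ k, (y k : ℝ) - L * Smax / r / 2) ^ 2)) +
        ENNReal.ofReal (2 * ε * ∑ k, (x k : ℝ)) ≤
      ENNReal.ofReal ((∑ k, (x k : ℝ) - L * Smax / r / 2) ^ 2 +
        r * (gap x + (L * Smax + Amax)) ^ 2 + L * Smax / r * ε + netSq svc arr) := by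
  -- κ is chosen so that κ r = L * Smax bounds the unused service U of a slot. The centring then
  -- contributes -κ U ≤ -U² / r, which completes a square below.
  set κ : ℝ := L * Smax / r with hκ
  set q : ℝ := ∑ k, (x k : ℝ) with hq
  have hε := ha.pos
  have hκr : κ * r = L * Smax := div_mul_cancel₀ _ hr.ne'
  refine expect_jsqKernel_add_le
    (c := (q - κ / 2) ^ 2 + r * (gap x + (L * Smax + Amax)) ^ 2) (γ := 1)
    (β := fun _ => 2 * q - κ) hs ha.bounded (fun y => sq_nonneg _) (by positivity) ?_ ?_
  · intro l _ a haA s hsS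
    set y : Fin L → ℕ := fun k => x k + (Pi.single l a : Fin L → ℕ) k - s k with hy
    set T : ℝ := ∑ k, (y k : ℝ) with hT
    have hz : ∑ k, net l a s k = (a : ℝ) - ∑ k, (s k : ℝ) := by
      simpa using sum_mul_net (fun _ => 1) l a s
    rw [← Finset.mul_sum, hz, one_mul]
    set z : ℝ := (a : ℝ) - ∑ k, (s k : ℝ) with hzdef
    set U : ℝ := T - (q + z) with hU
    have hUsum : U = ∑ k, ((y k : ℝ) - ((x k : ℝ) + net l a s k)) := by
      rw [Finset.sum_sub_distrib, Finset.sum_add_distrib, hz]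
    have hyk : ∀ k, (y k : ℝ) = max ((x k : ℝ) + net l a s k) 0 := fun k =>
      cast_add_sub_eq_max _ _ _
    have hsR : ∀ k, (s k : ℝ) ≤ Smax := fun k => by exact_mod_cast hsS k
    have hnet : ∀ k, -(Smax : ℝ) ≤ net l a s k := by
      intro k
      have : (0 : ℝ) ≤ ((Pi.single l a : Fin L → ℕ) k : ℝ) := Nat.cast_nonneg _
      rw [net]
      linarith [hsR k]
    have hU0 : 0 ≤ U := by
      rw [hUsum]
      exact Finset.sum_nonneg fun k _ => by
        rw [hyk]
        linarith [le_max_left ((x k : ℝ) + net l a s k) 0]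
    have hUC : U ≤ L * Smax := by
      have : (L : ℝ) * Smax = ∑ _k : Fin L, (Smax : ℝ) := by simp
      rw [hUsum, this]
      refine Finset.sum_le_sum fun k _ => ?_
      rw [hyk]
      have h1 : (0 : ℝ) ≤ x k := Nat.cast_nonneg _
      have h2 := hnet k
      rw [sub_le_iff_le_add]
      exact max_le (by linarith [Nat.cast_nonneg (α := ℝ) Smax]) (by linarith)
    -- With q + z = T - U, the effect of idling is isolated in one product that vanishes when no
    -- service is wasted.
    have hTU : (T - κ / 2) ^ 2 = (q + z - κ / 2) ^ 2 + U * (2 * T - U - κ) := by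
      have : q + z = T - U := by rw [hU]; ring
      rw [this]
      ring
    suffices h : U * (2 * T - U - κ) ≤ r * (gap x + (L * Smax + Amax)) ^ 2 by
      rw [hTU]
      nlinarith
    rcases hU0.eq_or_lt with h0 | hpos
    · rw [← h0, zero_mul]
      positivity
    -- Wasted service forces some queue to be shorter than `Smax`, so the new total is at most the
    -- gap plus a constant: this is where collapse enters.
    · have hex : ∃ k, ((x k : ℝ) + net l a s k) < 0 := by
        by_contra! hcon
        have : U = 0 := by
          rw [hUsum]
          exact Finset.sum_eq_zero fun k _ => by rw [hyk, max_eq_left (hcon k), sub_self]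
        linarith
      obtain ⟨k, hk⟩ := hex
      have hmin : (minLen x : ℝ) ≤ Smax := by
        have : (minLen x : ℝ) ≤ x k := by exact_mod_cast minLen_le x k
        linarith [hnet k]
      have hTle : T ≤ gap x + (L * Smax + Amax) := by
        have h1 : T ≤ q + a := by
          have : ∀ k, (y k : ℝ) ≤ (x k : ℝ) + ((Pi.single l a : Fin L → ℕ) k : ℝ) := fun k => by
            exact_mod_cast Nat.sub_le _ _
          refine (Finset.sum_le_sum fun k _ => this k).trans ?_
          rw [Finset.sum_add_distrib]
          gcongr
          exact_mod_cast (Finset.sum_pi_single' l a Finset.univ).le.trans (by simp)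
        have h2 : (a : ℝ) ≤ Amax := by exact_mod_cast haA
        have h3 : (L : ℝ) * minLen x ≤ L * Smax := by gcongr
        rw [hq, sum_eq_gap_add] at h1
        linarith
      set G := gap x + (L * Smax + Amax)
      have h1 : U * (2 * T - U - κ) ≤ U * (2 * G - κ) :=
        mul_le_mul_of_nonneg_left (by linarith) hU0
      refine h1.trans ?_
      -- From U ≤ κ r one gets r U (2G - κ) ≤ 2 r G U - U² ≤ (r G)².
      have h2 : r * (U * (2 * G - κ)) ≤ r * (r * G ^ 2) := by
        nlinarith [sq_nonneg (r * G - U)]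
      exact le_of_mul_le_mul_left h2 hr
  · intro l _
    have h2 : mean arr = muSum svc - ε := by linarith [ha.mean_eq]
    rw [← Finset.mul_sum, ← muSum, h2]
    apply le_of_eq
    ring

end Drift

/-! ### Existence of a steady state and the upper bound for JSQ -/

section Upper

variable {L : ℕ} {svc : Fin L → PMF ℕ} {arr : PMF ℕ} {Amax Smax : ℕ}

theorem meanTotal_eq_expect (π : PMF (Fin L → ℕ)) :
    meanTotal π = expect π fun x => ENNReal.ofReal (∑ k, (x k : ℝ)) := by
  rw [meanTotal, expect_eq_lintegral]
  refine lintegral_congr fun x => ?_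
  rw [← Nat.cast_sum, ENNReal.ofReal_natCast]

theorem var_nonneg (p : PMF ℕ) : 0 ≤ var p := variance_nonneg _ _

theorem nuSqSum_nonneg (svc : Fin L → PMF ℕ) : 0 ≤ nuSqSum svc :=
  Finset.sum_nonneg fun _ _ => var_nonneg _

theorem meanTotal_toReal_le {π : PMF (Fin L → ℕ)} {c b : ℝ} (hc : 0 < c) (hb : 0 ≤ b)
    (h : expect π (fun x => ENNReal.ofReal (c * ∑ k, (x k : ℝ))) ≤ ENNReal.ofReal b) :
    meanTotal π ≠ ∞ ∧ (meanTotal π).toReal ≤ b / c := by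
  simp only [ENNReal.ofReal_mul hc.le] at h
  rw [expect_const_mul, ← meanTotal_eq_expect] at h
  have hc' : ENNReal.ofReal c ≠ 0 := by simpa using hc
  have h2 : meanTotal π ≤ ENNReal.ofReal (b / c) := by
    rw [ENNReal.ofReal_div_of_pos hc, ENNReal.le_div_iff_mul_le (Or.inl hc')
      (Or.inl ENNReal.ofReal_ne_top), mul_comm]
    exact h
  exact ⟨ne_top_of_le_ne_top ENNReal.ofReal_ne_top h2,
    ENNReal.toReal_le_of_le_ofReal (by positivity) h2⟩

variable [NeZero L]

theorem exists_steadyState_JSQ (hs : ∀ l, BoundedBy (svc l) Smax) {ε δ : ℝ}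
    (ha : IsArrivalLaw svc Amax ε arr) (hδ : 0 < δ) (hδμ : ∀ k, δ ≤ mean (svc k))
    (hδε : L * δ ≤ ε) : ∃ π, IsSteadyState svc arr (JSQ L) π := by
  have hsub : ∀ R : ℕ,
      {x : Fin L → ℕ | ENNReal.ofReal (2 * δ * ∑ k, (x k : ℝ)) < R}.Finite := by
    intro R
    obtain ⟨n, hn⟩ := exists_nat_ge ((R : ℝ) / (2 * δ))
    refine (Set.finite_Icc 0 fun _ => n).subset fun x hx => ?_
    refine ⟨fun _ => Nat.zero_le _, fun k => ?_⟩
    have hx : ENNReal.ofReal (2 * δ * ∑ k, (x k : ℝ)) < R := hx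
    rw [← ENNReal.ofReal_natCast, ENNReal.ofReal_lt_ofReal_iff_of_nonneg (by positivity)] at hx
    rw [div_le_iff₀ (by positivity)] at hn
    have h1 : (x k : ℝ) ≤ ∑ k, (x k : ℝ) :=
      Finset.single_le_sum (f := fun k => (x k : ℝ)) (fun _ _ => Nat.cast_nonneg _)
        (Finset.mem_univ k)
    have h2 : ∑ k, (x k : ℝ) ≤ n := by nlinarith
    exact_mod_cast h1.trans h2
  obtain ⟨π, hπ⟩ := exists_stationary_of_drift (K := jsqKernel svc arr) 0
    (V := fun y => ENNReal.ofReal (∑ k, (y k : ℝ) ^ 2))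
    (b := ENNReal.ofReal (L * ((Amax : ℝ) + Smax) ^ 2))
    ENNReal.ofReal_ne_top ENNReal.ofReal_ne_top (finite_predecessors_jsqKernel hs) hsub
    fun x => by
      rw [← ENNReal.ofReal_add (by positivity) (by positivity)]
      exact expect_jsqKernel_sum_sq hs ha hδ hδμ hδε x
  exact ⟨π, isSteadyState_of_stationary hπ⟩

theorem meanTotal_le_of_stationary (hs : ∀ l, BoundedBy (svc l) Smax) {ε δ : ℝ}
    (ha : IsArrivalLaw svc Amax ε arr) (hδ : 0 < δ) (hδμ : ∀ k, δ ≤ mean (svc k))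
    (hδε : L * δ ≤ ε) {π : PMF (Fin L → ℕ)} (hπ : π.bind (jsqKernel svc arr) = π) :
    meanTotal π ≠ ∞ ∧
      (meanTotal π).toReal ≤ L * ((Amax : ℝ) + Smax) ^ 2 / (2 * δ) := by
  refine meanTotal_toReal_le (by positivity) (by positivity) ?_
  rw [← expect_const π (ENNReal.ofReal _)]
  refine expect_le_of_drift hπ (V := fun y => ENNReal.ofReal (∑ k, (y k : ℝ) ^ 2))
    (fun _ => ENNReal.ofReal_ne_top) fun x => ?_
  rw [← ENNReal.ofReal_add (by positivity) (by positivity)]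
  exact expect_jsqKernel_sum_sq hs ha hδ hδμ hδε x

/-- The drift of the total is used with r = √ε, which balances its two costs: r times a bounded
second moment, and (L * Smax / r) ε, are both of order √ε. -/
theorem meanTotal_le_of_expect_gap_sq_le (hs : ∀ l, BoundedBy (svc l) Smax) {ε M : ℝ}
    (ha : IsArrivalLaw svc Amax ε arr) (hM : 0 ≤ M) {π : PMF (Fin L → ℕ)}
    (hπ : π.bind (jsqKernel svc arr) = π)
    (hgap : expect π (fun x => ENNReal.ofReal (gap x ^ 2)) ≤ ENNReal.ofReal M) :
    (meanTotal π).toReal ≤ (var arr + nuSqSum svc) / (2 * ε) +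
      (√ε * (2 * M + 2 * (L * Smax + Amax) ^ 2 + L * Smax) + ε ^ 2) / (2 * ε) := by
  have hε := ha.pos
  have hr : 0 < √ε := Real.sqrt_pos.2 hε
  have hζ : 0 ≤ var arr + nuSqSum svc := add_nonneg (var_nonneg _) (nuSqSum_nonneg _)
  have hnet : netSq svc arr = var arr + nuSqSum svc + ε ^ 2 := by rw [netSq, ← ha.mean_eq]
  set c : ℝ := √ε * (2 * (L * Smax + Amax) ^ 2 + L * Smax) + (var arr + nuSqSum svc) + ε ^ 2
    with hc
  have hc0 : 0 ≤ c := by positivity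
  have hκ : (L : ℝ) * Smax / √ε * ε = √ε * (L * Smax) := by
    rw [div_mul_eq_mul_div, div_eq_iff hr.ne']
    linear_combination -((L : ℝ) * Smax) * Real.mul_self_sqrt hε.le
  have key : expect π (fun x => ENNReal.ofReal (2 * ε * ∑ k, (x k : ℝ))) ≤
      expect π fun x => ENNReal.ofReal (2 * √ε) * ENNReal.ofReal (gap x ^ 2) +
        ENNReal.ofReal c := by
    refine expect_le_of_drift hπ
      (V := fun y => ENNReal.ofReal ((∑ k, (y k : ℝ) - L * Smax / √ε / 2) ^ 2))
      (fun _ => ENNReal.ofReal_ne_top) fun x => ?_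
    refine (expect_jsqKernel_total hs ha hr x).trans ?_
    rw [← ENNReal.ofReal_mul (by positivity), ← ENNReal.ofReal_add (by positivity) hc0,
      ← ENNReal.ofReal_add (sq_nonneg _) (by positivity)]
    refine ENNReal.ofReal_le_ofReal ?_
    rw [hκ, hnet, hc]
    have h1 : (gap x + (L * Smax + Amax)) ^ 2 ≤
        2 * gap x ^ 2 + 2 * ((L : ℝ) * Smax + Amax) ^ 2 := by
      nlinarith [sq_nonneg (gap x - (L * Smax + Amax))]
    have h2 := mul_le_mul_of_nonneg_left h1 hr.le
    linarith
  have h2 : expect π (fun x => ENNReal.ofReal (2 * ε * ∑ k, (x k : ℝ))) ≤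
      ENNReal.ofReal (2 * √ε * M + c) := by
    refine key.trans ?_
    rw [expect_add, expect_const, expect_const_mul, ENNReal.ofReal_add (by positivity) hc0,
      ENNReal.ofReal_mul (p := 2 * √ε) (by positivity)]
    exact add_le_add_left (mul_le_mul_right hgap _) _
  refine (meanTotal_toReal_le (by positivity) (by positivity) h2).2.trans (le_of_eq ?_)
  rw [← add_div, hc]
  ring

theorem exists_pos_le_mean (hpos : ∀ l, 0 < mean (svc l)) :
    ∃ μ₀ : ℝ, 0 < μ₀ ∧ ∀ l, μ₀ ≤ mean (svc l) := by
  obtain ⟨l, hl⟩ := Finite.exists_min fun l => mean (svc l)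
  exact ⟨_, hpos l, hl⟩

theorem exists_upper_bound_JSQ (hs : ∀ l, BoundedBy (svc l) Smax)
    (hpos : ∀ l, 0 < mean (svc l)) (Amax : ℕ) :
    ∃ B : ℝ → ℝ, Tendsto (fun ε => ε * B ε) (𝓝[>] 0) (𝓝 0) ∧
      ∀ (ε : ℝ) (arr : PMF ℕ), IsArrivalLaw svc Amax ε arr →
        ∀ π, IsSteadyState svc arr (JSQ L) π →
          meanTotal π ≠ ∞ ∧
          (meanTotal π).toReal ≤ (var arr + nuSqSum svc) / (2 * ε) + B ε := by
  classical
  obtain ⟨μ₀, hμ₀, hμ⟩ := exists_pos_le_mean hpos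
  obtain ⟨M, hM, hgap⟩ := exists_expect_gap_sq_le hs hμ₀ hμ Amax
  have hL : (0 : ℝ) < L := zero_lt_one.trans_le card_pos_real
  set C : ℝ := 2 * M + 2 * (L * Smax + Amax) ^ 2 + L * Smax with hC
  -- The sharp bound needs ε ≤ μ₀ / 2 for the collapse; beyond that, the crude bound from the sum of
  -- squares suffices, since the limit sees only small ε.
  refine ⟨fun ε => if ε ≤ μ₀ / 2 then (√ε * C + ε ^ 2) / (2 * ε)
    else L * ((Amax : ℝ) + Smax) ^ 2 / (2 * min (ε / L) μ₀), ?_, ?_⟩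
  · have h1 : Tendsto (fun ε : ℝ => (√ε * C + ε ^ 2) / 2) (𝓝[>] 0) (𝓝 0) := by
      have : Continuous fun ε : ℝ => (√ε * C + ε ^ 2) / 2 := by fun_prop
      simpa using (this.tendsto 0).mono_left nhdsWithin_le_nhds
    refine h1.congr' ?_
    filter_upwards [Ioc_mem_nhdsGT (half_pos hμ₀)] with ε hε
    have := hε.1.ne'
    rw [if_pos hε.2]
    field_simp
  · intro ε arr ha π hπ
    have hst := hπ.stationary hs
    have hε := ha.pos
    have hcrude := meanTotal_le_of_stationary hs ha (δ := min (ε / L) μ₀) (by positivity)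
      (fun k => (min_le_right _ _).trans (hμ k))
      (by rw [mul_comm]; exact (le_div_iff₀ hL).1 (min_le_left _ _)) hst
    refine ⟨hcrude.1, ?_⟩
    dsimp only
    split_ifs with h
    · exact meanTotal_le_of_expect_gap_sq_le hs ha hM hst (hgap ε arr ha h π hst)
    · have hζ : 0 ≤ var arr + nuSqSum svc := add_nonneg (var_nonneg _) (nuSqSum_nonneg _)
      exact hcrude.2.trans (le_add_of_nonneg_left (by positivity))

end Upper

/-! ### The pooled single-server queue and the lower bound for all policies -/

section Lower

variable {L : ℕ} {svc : Fin L → PMF ℕ} {arr : PMF ℕ} {Amax Smax : ℕ}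

variable (svc arr) in
/-- Transition operator of the single-server queue that pools the services of all queues. -/
def pooled (f : ℕ → ℝ) (n : ℕ) : ℝ := ∫ ω, f (n + ω.1 - ∑ l, ω.2 l) ∂slot svc arr

variable (svc arr) in
/-- Expectation of `f` at time `t` for the pooled queue started empty. -/
def pooledExpect (t : ℕ) (f : ℕ → ℝ) : ℝ := (pooled svc arr)^[t] f 0

theorem pooled_mono (hs : ∀ l, BoundedBy (svc l) Smax) (ha : BoundedBy arr Amax) :
    Monotone (pooled svc arr) := fun _ _ h _ =>
  integral_mono (integrable_slot hs ha _) (integrable_slot hs ha _) fun _ => h _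

theorem pooled_monotone (hs : ∀ l, BoundedBy (svc l) Smax) (ha : BoundedBy arr Amax)
    {f : ℕ → ℝ} (hf : Monotone f) : Monotone (pooled svc arr f) := fun m n hmn =>
  integral_mono (integrable_slot hs ha _) (integrable_slot hs ha _) fun ω => hf (by
    omega)

theorem pooledExpect_mono (hs : ∀ l, BoundedBy (svc l) Smax) (ha : BoundedBy arr Amax)
    (t : ℕ) {f g : ℕ → ℝ} (h : f ≤ g) : pooledExpect svc arr t f ≤ pooledExpect svc arr t g :=
  (pooled_mono hs ha).iterate t h 0

theorem pooledExpect_succ (t : ℕ) (f : ℕ → ℝ) :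
    pooledExpect svc arr (t + 1) f = pooledExpect svc arr t (pooled svc arr f) := rfl

/-- A queue started empty is stochastically increasing: after one slot it is at least empty, and the
dynamics preserve order. -/
theorem monotone_pooledExpect (hs : ∀ l, BoundedBy (svc l) Smax) (ha : BoundedBy arr Amax)
    {f : ℕ → ℝ} (hf : Monotone f) : Monotone fun t => pooledExpect svc arr t f := by
  refine monotone_nat_of_le_succ fun t => ?_
  have hmono : Monotone ((pooled svc arr)^[t] f) := by
    induction t with
    | zero => exact hf
    | succ t ih =>
      rw [Function.iterate_succ_apply']
      exact pooled_monotone hs ha ih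
  simp only [pooledExpect, Function.iterate_succ_apply']
  set g := (pooled svc arr)^[t] f
  calc g 0 = ∫ _, g 0 ∂slot svc arr := by simp
    _ ≤ _ := integral_mono (integrable_slot hs ha _) (integrable_slot hs ha _)
        fun ω => hmono (Nat.zero_le _)

theorem pooled_affine (hs : ∀ l, BoundedBy (svc l) Smax) (ha : BoundedBy arr Amax)
    (f g : ℕ → ℝ) (c d : ℝ) : pooled svc arr (fun n => f n + c * g n + d) =
      fun n => pooled svc arr f n + c * pooled svc arr g n + d := by
  funext n
  have hint := integrable_slot (svc := svc) (arr := arr) hs ha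
  rw [pooled, integral_add (hint _) (hint _), integral_add (hint _) (hint _), integral_const_mul]
  simp [pooled]

theorem pooledExpect_affine (hs : ∀ l, BoundedBy (svc l) Smax) (ha : BoundedBy arr Amax)
    (t : ℕ) (f g : ℕ → ℝ) (c d : ℝ) : pooledExpect svc arr t (fun n => f n + c * g n + d) =
      pooledExpect svc arr t f + c * pooledExpect svc arr t g + d := by
  induction t generalizing f g with
  | zero => rfl
  | succ t ih => rw [pooledExpect_succ, pooled_affine hs ha, ih, pooledExpect_succ,
      pooledExpect_succ]

theorem integral_slot_quadratic (hs : ∀ l, BoundedBy (svc l) Smax) (ha : BoundedBy arr Amax)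
    (c β γ : ℝ) :
    ∫ ω, (c + β * ((ω.1 : ℝ) - ∑ k, (ω.2 k : ℝ)) + γ * ((ω.1 : ℝ) - ∑ k, (ω.2 k : ℝ)) ^ 2)
      ∂slot svc arr = c + β * (mean arr - muSum svc) + γ * netSq svc arr := by
  have hint := integrable_slot (svc := svc) (arr := arr) hs ha
  rw [integral_add (hint _) (hint _), integral_add (hint _) (hint _), integral_const_mul,
    integral_const_mul, integral_slot_net hs ha, integral_slot_net_sq hs ha]
  simp [netSq]

theorem sum_services_le {s : Fin L → ℕ} (hs : ∀ k, s k ≤ Smax) :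
    ∑ k, (s k : ℝ) ≤ L * Smax := by
  have : (L : ℝ) * Smax = ∑ _k : Fin L, (Smax : ℝ) := by simp
  rw [this]
  exact Finset.sum_le_sum fun k _ => by exact_mod_cast hs k

theorem cast_pooled_step (n a : ℕ) (s : Fin L → ℕ) :
    ((n + a - ∑ k, s k : ℕ) : ℝ) = max ((n : ℝ) + ((a : ℝ) - ∑ k, (s k : ℝ))) 0 := by
  rw [cast_add_sub_eq_max, Nat.cast_sum]

/-- The linear term pays for idling: if n + z < 0 for the net input z, then n + z ≥ -L * Smax, so (n
+ z)² + L * Smax * (n + z) ≤ 0, and truncation at zero only raises the test function. -/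
theorem le_pooled_quadratic (hs : ∀ l, BoundedBy (svc l) Smax) {ε : ℝ}
    (ha : IsArrivalLaw svc Amax ε arr) (n : ℕ) :
    ((n : ℝ) ^ 2 + L * Smax * n) + -(2 * ε) * n + (netSq svc arr - L * Smax * ε) ≤
      pooled svc arr (fun n => (n : ℝ) ^ 2 + L * Smax * n) n := by
  have h := integral_slot_quadratic hs ha.bounded ((n : ℝ) ^ 2 + L * Smax * n)
    (2 * n + L * Smax) 1
  have hε : mean arr - muSum svc = -ε := by linarith [ha.mean_eq]
  rw [hε] at h
  calc _ = (n : ℝ) ^ 2 + L * Smax * n + (2 * n + L * Smax) * -ε + 1 * netSq svc arr := by ring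
    _ ≤ _ := by
      rw [← h]
      refine integral_mono_ae (integrable_slot hs ha.bounded _) (integrable_slot hs ha.bounded _) ?_
      filter_upwards [ae_slot_le hs ha.bounded] with ω hω
      have h1 := sum_services_le hω.2
      have h2 : (0 : ℝ) ≤ ω.1 := Nat.cast_nonneg _
      have h3 : (0 : ℝ) ≤ n := Nat.cast_nonneg _
      rw [cast_pooled_step]
      rcases le_total 0 ((n : ℝ) + ((ω.1 : ℝ) - ∑ k, (ω.2 k : ℝ))) with h0 | h0
      · rw [max_eq_left h0]
        apply le_of_eq
        ring
      · rw [max_eq_right h0]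
        nlinarith

theorem pooled_cubic_le (hs : ∀ l, BoundedBy (svc l) Smax) {ε : ℝ}
    (ha : IsArrivalLaw svc Amax ε arr) (n : ℕ) :
    pooled svc arr (fun n => (n : ℝ) ^ 3) n ≤
      (n : ℝ) ^ 3 - 3 * ε * n ^ 2 + 3 * (Amax + L * Smax) ^ 2 * n +
        2 * (Amax + L * Smax) ^ 3 := by
  set C : ℝ := Amax + L * Smax with hC
  have h := integral_slot_quadratic hs ha.bounded ((n : ℝ) ^ 3 + 3 * C ^ 2 * n + 2 * C ^ 3)
    (3 * n ^ 2) 0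
  have hε : mean arr - muSum svc = -ε := by linarith [ha.mean_eq]
  rw [hε] at h
  calc _ ≤ (n : ℝ) ^ 3 + 3 * C ^ 2 * n + 2 * C ^ 3 + 3 * n ^ 2 * -ε + 0 * netSq svc arr := by
        rw [← h]
        refine integral_mono_ae (integrable_slot hs ha.bounded _)
          (integrable_slot hs ha.bounded _) ?_
        filter_upwards [ae_slot_le hs ha.bounded] with ω hω
        have h1 := sum_services_le hω.2
        have h2 : (0 : ℝ) ≤ ω.1 := Nat.cast_nonneg _
        have h3 : (0 : ℝ) ≤ n := Nat.cast_nonneg _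
        have h4 : (ω.1 : ℝ) ≤ Amax := by exact_mod_cast hω.1
        have h5 : (0 : ℝ) ≤ ∑ k, (ω.2 k : ℝ) := Finset.sum_nonneg fun _ _ => Nat.cast_nonneg _
        rw [cast_pooled_step]
        set z : ℝ := (ω.1 : ℝ) - ∑ k, (ω.2 k : ℝ) with hz
        have hC0 : 0 ≤ C := by positivity
        have hA : (0 : ℝ) ≤ Amax := Nat.cast_nonneg _
        have hS : (0 : ℝ) ≤ L * Smax := by positivity
        have hzC : |z| ≤ C := by
          rw [abs_le]
          constructor <;> linarith
        have hz2 : z ^ 2 ≤ C ^ 2 := sq_le_sq.2 (hzC.trans (le_abs_self C))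
        have hz3 : |z ^ 3| ≤ C ^ 3 := by
          rw [abs_pow]
          exact pow_le_pow_left₀ (abs_nonneg z) hzC 3
        have hz3' := abs_le.1 hz3
        have h6 : n * z ^ 2 ≤ n * C ^ 2 := mul_le_mul_of_nonneg_left hz2 h3
        rcases le_total 0 ((n : ℝ) + z) with h0 | h0
        · rw [max_eq_left h0]
          nlinarith
        · rw [max_eq_right h0]
          have h7 : (-((n : ℝ) + z)) ^ 3 ≤ C ^ 3 :=
            pow_le_pow_left₀ (by linarith) (by linarith [(abs_le.1 hzC).1]) 3
          nlinarith
    _ = _ := by ring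

/-- Third moments are nondecreasing in time, so the mean cubic drift is nonnegative; its leading
term -3ε n² then bounds second moments uniformly in t, without any bound on third moments. -/
theorem pooledExpect_quadratic_le (hs : ∀ l, BoundedBy (svc l) Smax) {ε : ℝ}
    (ha : IsArrivalLaw svc Amax ε arr) : ∃ M : ℝ, 0 ≤ M ∧
      ∀ t, pooledExpect svc arr t (fun n => (n : ℝ) ^ 2 + L * Smax * n) ≤ M := by
  have hε := ha.pos
  set C : ℝ := Amax + L * Smax with hC
  have hC0 : 0 ≤ C := by positivity
  set b : ℝ := 3 * C ^ 2 + ε * (L * Smax) with hb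
  set d : ℝ := 2 * C ^ 3 + b ^ 2 / (8 * ε) with hd
  refine ⟨d / ε, by positivity, fun t => ?_⟩
  have h1 : pooledExpect svc arr t (fun n => (n : ℝ) ^ 3) ≤
      pooledExpect svc arr (t + 1) (fun n => (n : ℝ) ^ 3) :=
    monotone_pooledExpect hs ha.bounded
      (fun m n hmn => pow_le_pow_left₀ (Nat.cast_nonneg _) (by exact_mod_cast hmn) 3) t.le_succ
  have h2 : pooledExpect svc arr (t + 1) (fun n => (n : ℝ) ^ 3) ≤
      pooledExpect svc arr t (fun n => (n : ℝ) ^ 3 + -ε * ((n : ℝ) ^ 2 + L * Smax * n) + d) := by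
    rw [pooledExpect_succ]
    refine pooledExpect_mono hs ha.bounded t fun n => (pooled_cubic_le hs ha n).trans ?_
    -- Completing the square fixes the constant b² / (8ε).
    have h3 : 0 ≤ 2 * ε * (n : ℝ) ^ 2 - b * n + b ^ 2 / (8 * ε) := by
      have : 2 * ε * (n : ℝ) ^ 2 - b * n + b ^ 2 / (8 * ε) =
          2 * ε * (n - b / (4 * ε)) ^ 2 := by
        field_simp
        ring
      rw [this]
      positivity
    rw [hd]
    rw [hb] at h3 ⊢
    linarith
  rw [pooledExpect_affine hs ha.bounded] at h2
  rw [le_div_iff₀ hε]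
  linarith

/-- The total queue length under any policy dominates the pooled queue. -/
theorem ofReal_pooledExpect_le (hs : ∀ l, BoundedBy (svc l) Smax) (ha : BoundedBy arr Amax)
    (P : Policy L) (init : PMF ((Fin L → ℕ) × P.Mem)) (t : ℕ) {f : ℕ → ℝ} (hf : Monotone f)
    (hf0 : ∀ n, 0 ≤ f n) : ENNReal.ofReal (pooledExpect svc arr t f) ≤
      expect (lawAt svc arr P init t) fun x => ENNReal.ofReal (f (∑ k, x.1 k)) := by
  induction t generalizing f with
  | zero =>
    rw [← expect_const (lawAt svc arr P init 0) (ENNReal.ofReal _)]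
    exact expect_mono _ fun x => ENNReal.ofReal_le_ofReal (hf (Nat.zero_le _))
  | succ t ih =>
    rw [pooledExpect_succ, lawAt, expect_bind]
    refine (ih (pooled_monotone hs ha hf) fun n => integral_nonneg fun _ => hf0 _).trans ?_
    refine expect_mono _ fun x => ?_
    have h1 : ENNReal.ofReal (pooled svc arr f (∑ k, x.1 k)) =
        expect arr fun a => expect (serviceLaw svc) fun s =>
          ENNReal.ofReal (f (∑ k, x.1 k + a - ∑ k, s k)) := by
      rw [pooled, ofReal_integral_eq_lintegral_ofReal (integrable_slot hs ha _)
        (ae_of_all _ fun _ => hf0 _), expect_slot]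
    rw [h1, step, expect_bind]
    refine expect_mono _ fun a => ?_
    -- The pooled quantity depends on the allocation only through its sum, so it is constant over
    -- the router's choices. Pathwise, truncating the sum at zero gives at most the sum of the
    -- truncations.
    rw [expect_bind, ← expect_const (P.route x.1 x.2 a) (expect (serviceLaw svc) _)]
    refine expect_mono_support _ fun v hv => ?_
    rw [expect_map]
    refine expect_mono _ fun s => ENNReal.ofReal_le_ofReal (hf ?_)
    rw [← P.feasible x.1 x.2 a v hv, ← Finset.sum_add_distrib, Nat.sub_le_iff_le_add,
      ← Finset.sum_add_distrib]
    exact Finset.sum_le_sum fun k _ => by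
      dsimp only
      omega

theorem tendsto_expect_min {p : ℕ → PMF (Fin L → ℕ)} {π : PMF (Fin L → ℕ)}
    (h : Tendsto (fun t => toProbMeasure (p t)) atTop (𝓝 (toProbMeasure π))) (N : ℕ) :
    Tendsto (fun t => expect (p t) fun x => ENNReal.ofReal (min ((∑ k, x k : ℕ) : ℝ) N)) atTop
      (𝓝 (expect π fun x => ENNReal.ofReal (min ((∑ k, x k : ℕ) : ℝ) N))) := by
  let g : BoundedContinuousFunction (Fin L → ℕ) NNReal :=
    BoundedContinuousFunction.mkOfBound
      ⟨fun x => min ((∑ k, x k : ℕ) : NNReal) N, continuous_of_discreteTopology⟩ N (by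
        intro x y
        rw [NNReal.dist_eq, abs_le]
        have h1 : ∀ x : Fin L → ℕ, ((min ((∑ k, x k : ℕ) : NNReal) N : NNReal) : ℝ) ≤ N :=
          fun x => by exact_mod_cast min_le_right _ _
        have h2 : ∀ x : Fin L → ℕ, (0 : ℝ) ≤ (min ((∑ k, x k : ℕ) : NNReal) N : NNReal) :=
          fun x => NNReal.coe_nonneg _
        have := h1 x
        have := h1 y
        have := h2 x
        have := h2 y
        constructor <;> simp only [ContinuousMap.coe_mk] <;> linarith)
  have hg : ∀ x, ENNReal.ofReal (min ((∑ k, x k : ℕ) : ℝ) N) = (g x : ℝ≥0∞) := by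
    intro x
    rw [ENNReal.ofReal, ENNReal.coe_inj]
    change _ = min ((∑ k, x k : ℕ) : NNReal) N
    rw [Monotone.map_min fun _ _ => Real.toNNReal_mono, Real.toNNReal_natCast, Real.toNNReal_natCast]
  simp only [hg, expect_eq_lintegral]
  exact ProbabilityMeasure.tendsto_iff_forall_lintegral_tendsto.1 h g

/-- The truncation at N makes the test function bounded, so domination at times u ≥ t survives the
weak limit; monotonicity in time keeps the fixed t on the left. -/
theorem pooledExpect_min_le (hs : ∀ l, BoundedBy (svc l) Smax) (ha : BoundedBy arr Amax)
    {P : Policy L} {π : PMF (Fin L → ℕ)} (hπ : IsSteadyState svc arr P π) (t N : ℕ) :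
    ENNReal.ofReal (pooledExpect svc arr t fun n => min (n : ℝ) N) ≤ meanTotal π := by
  obtain ⟨init, hinit⟩ := hπ
  have hmono : Monotone fun n : ℕ => min (n : ℝ) N := fun m n hmn =>
    min_le_min_right _ (by exact_mod_cast hmn)
  have h1 : ENNReal.ofReal (pooledExpect svc arr t fun n => min (n : ℝ) N) ≤
      expect π fun x => ENNReal.ofReal (min ((∑ k, x k : ℕ) : ℝ) N) := by
    refine ge_of_tendsto (tendsto_expect_min hinit N) ?_
    filter_upwards [eventually_ge_atTop t] with u hu
    rw [expect_map]
    refine le_trans (ENNReal.ofReal_le_ofReal (monotone_pooledExpect hs ha hmono hu)) ?_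
    exact ofReal_pooledExpect_le hs ha P init u hmono fun n => by positivity
  refine h1.trans ?_
  rw [meanTotal_eq_expect]
  refine expect_mono _ fun x => ENNReal.ofReal_le_ofReal ?_
  rw [← Nat.cast_sum]
  exact min_le_left _ _

/-- Lower bound on the stationary mean total queue length under an arbitrary policy. -/
theorem le_meanTotal (hs : ∀ l, BoundedBy (svc l) Smax) {ε : ℝ}
    (ha : IsArrivalLaw svc Amax ε arr) {P : Policy L} {π : PMF (Fin L → ℕ)}
    (hπ : IsSteadyState svc arr P π) :
    ENNReal.ofReal ((var arr + nuSqSum svc + ε ^ 2 - L * Smax * ε) / 2) ≤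
      ENNReal.ofReal ε * meanTotal π := by
  have hε := ha.pos
  by_cases htop : meanTotal π = ∞
  · rw [htop, ENNReal.mul_top (by simpa using hε)]
    exact le_top
  set X := (meanTotal π).toReal with hX
  obtain ⟨M, hM0, hM⟩ := pooledExpect_quadratic_le hs ha
  have h1 : ∀ t, pooledExpect svc arr t (fun n => (n : ℝ)) ≤ X := by
    intro t
    have h2 : ∀ N : ℕ, pooledExpect svc arr t (fun n => (n : ℝ)) - M / (N + 1 : ℝ) ≤ X := by
      intro N
      have h3 := (ENNReal.ofReal_le_iff_le_toReal htop).1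
        (pooledExpect_min_le hs ha.bounded hπ t (N + 1))
      refine le_trans ?_ h3
      -- The truncation is removed through n - (n² + L * Smax * n) / (N + 1) ≤ min n (N + 1), whose
      -- error is at most M / (N + 1) uniformly in t.
      have h4 := pooledExpect_mono (svc := svc) (arr := arr) hs ha.bounded t
        (f := fun n => (n : ℝ) + -(1 / (N + 1 : ℝ)) * ((n : ℝ) ^ 2 + L * Smax * n) + 0)
        (g := fun n => min (n : ℝ) ((N + 1 : ℕ) : ℝ)) (by
          intro n
          have hn : (0 : ℝ) ≤ n := Nat.cast_nonneg _
          have hN : (0 : ℝ) < N + 1 := by positivity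
          have h5 : 0 ≤ 1 / (N + 1 : ℝ) * ((n : ℝ) ^ 2 + L * Smax * n) := by positivity
          push_cast
          refine le_min (by linarith) ?_
          rcases le_total (n : ℝ) (N + 1) with h | h
          · linarith
          · have h6 : (n : ℝ) ≤ 1 / (N + 1 : ℝ) * ((n : ℝ) ^ 2 + L * Smax * n) := by
              rw [one_div, inv_mul_eq_div, le_div_iff₀ hN]
              have : (0 : ℝ) ≤ L * Smax * n := by positivity
              nlinarith
            linarith)
      rw [pooledExpect_affine hs ha.bounded] at h4
      refine le_trans ?_ h4
      have h5 : M / (N + 1 : ℝ) ≥ 1 / (N + 1 : ℝ) *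
          pooledExpect svc arr t (fun n => (n : ℝ) ^ 2 + L * Smax * n) := by
        rw [div_mul_eq_mul_div, one_mul]
        gcongr
        exact hM t
      linarith
    have h3 : Tendsto (fun N : ℕ => pooledExpect svc arr t (fun n => (n : ℝ)) - M / (N + 1 : ℝ))
        atTop (𝓝 (pooledExpect svc arr t (fun n => (n : ℝ)) - 0)) := by
      refine Tendsto.const_sub _ ?_
      have := (tendsto_one_div_add_atTop_nhds_zero_nat (𝕜 := ℝ)).const_mul M
      simpa [div_eq_mul_inv] using this
    simpa using le_of_tendsto' h3 h2
  set r : ℕ → ℝ := fun t => pooledExpect svc arr t fun n => (n : ℝ) ^ 2 + L * Smax * n with hr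
  have hrmono : Monotone r := monotone_pooledExpect hs ha.bounded fun m n hmn => by
    have : (m : ℝ) ≤ n := by exact_mod_cast hmn
    gcongr
  have hrlim := tendsto_atTop_ciSup hrmono ⟨M, by rintro _ ⟨t, rfl⟩; exact hM t⟩
  -- A bounded monotone sequence has vanishing increments; this replaces a stationary law of the
  -- pooled queue.
  have hdiff : Tendsto (fun t => r (t + 1) - r t) atTop (𝓝 0) := by
    simpa using ((tendsto_add_atTop_iff_nat 1).2 hrlim).sub hrlim
  have h2 : ∀ t, netSq svc arr - L * Smax * ε - 2 * ε * X ≤ r (t + 1) - r t := by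
    intro t
    have h3 := pooledExpect_mono (svc := svc) (arr := arr) hs ha.bounded t
      (le_pooled_quadratic hs ha)
    rw [pooledExpect_affine hs ha.bounded, ← pooledExpect_succ] at h3
    have h4 := mul_le_mul_of_nonneg_left (h1 t) (by positivity : 0 ≤ 2 * ε)
    change r t + _ + _ ≤ r (t + 1) at h3
    linarith
  have h3 := ge_of_tendsto' hdiff h2
  have hnet : netSq svc arr = var arr + nuSqSum svc + ε ^ 2 := by rw [netSq, ← ha.mean_eq]
  rw [← ENNReal.ofReal_toReal htop, ← ENNReal.ofReal_mul hε.le]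
  refine ENNReal.ofReal_le_ofReal ?_
  linarith

end Lower

/-! ### Passage to the heavy-traffic limit -/

section HeavyTraffic

variable {L : ℕ} {svc : Fin L → PMF ℕ} {Amax Smax : ℕ} {ι : Type*} {F : Filter ι} {ε : ι → ℝ}
  {arr : ι → PMF ℕ} {σSq : ℝ}

theorem le_liminf_meanTotal (hs : ∀ l, BoundedBy (svc l) Smax) (hε : Tendsto ε F (𝓝[>] 0))
    (harr : ∀ᶠ i in F, IsArrivalLaw svc Amax (ε i) (arr i))
    (hσ : Tendsto (fun i => var (arr i)) F (𝓝 σSq)) {P : ι → Policy L}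
    {π : ι → PMF (Fin L → ℕ)} (hπ : ∀ᶠ i in F, IsSteadyState svc (arr i) (P i) (π i)) :
    ENNReal.ofReal ((σSq + nuSqSum svc) / 2) ≤
      liminf (fun i => ENNReal.ofReal (ε i) * meanTotal (π i)) F := by
  rcases F.eq_or_neBot with rfl | hF
  · simp
  have hε0 : Tendsto ε F (𝓝 0) := hε.mono_right nhdsWithin_le_nhds
  have hlim : Tendsto (fun i => ENNReal.ofReal
      ((var (arr i) + nuSqSum svc + ε i ^ 2 - L * Smax * ε i) / 2)) F
      (𝓝 (ENNReal.ofReal ((σSq + nuSqSum svc) / 2))) := by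
    refine ENNReal.tendsto_ofReal ?_
    have := (((hσ.add_const (nuSqSum svc)).add (hε0.pow 2)).sub
      (hε0.const_mul ((L : ℝ) * Smax))).div_const 2
    simpa using this
  rw [← hlim.liminf_eq]
  refine liminf_le_liminf ?_
  filter_upwards [harr, hπ] with i ha h
  exact le_meanTotal hs ha h

theorem limsup_meanTotal_JSQ_le [NeZero L] (hs : ∀ l, BoundedBy (svc l) Smax)
    (hpos : ∀ l, 0 < mean (svc l)) (hε : Tendsto ε F (𝓝[>] 0))
    (harr : ∀ᶠ i in F, IsArrivalLaw svc Amax (ε i) (arr i))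
    (hσ : Tendsto (fun i => var (arr i)) F (𝓝 σSq)) {π : ι → PMF (Fin L → ℕ)}
    (hπ : ∀ᶠ i in F, IsSteadyState svc (arr i) (JSQ L) (π i)) :
    limsup (fun i => ENNReal.ofReal (ε i) * meanTotal (π i)) F ≤
      ENNReal.ofReal ((σSq + nuSqSum svc) / 2) := by
  rcases F.eq_or_neBot with rfl | hF
  · simp
  obtain ⟨B, hB, hbound⟩ := exists_upper_bound_JSQ hs hpos Amax
  have hlim : Tendsto (fun i => ENNReal.ofReal
      ((var (arr i) + nuSqSum svc) / 2 + ε i * B (ε i))) F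
      (𝓝 (ENNReal.ofReal ((σSq + nuSqSum svc) / 2))) := by
    refine ENNReal.tendsto_ofReal ?_
    simpa using ((hσ.add_const (nuSqSum svc)).div_const 2).add (hB.comp hε)
  rw [← hlim.limsup_eq]
  refine limsup_le_limsup ?_
  filter_upwards [harr, hπ] with i ha h
  obtain ⟨h1, h2⟩ := hbound (ε i) (arr i) ha (π i) h
  have hεi := ha.pos
  rw [← ENNReal.ofReal_toReal h1, ← ENNReal.ofReal_mul hεi.le]
  refine ENNReal.ofReal_le_ofReal ?_
  calc _ ≤ ε i * ((var (arr i) + nuSqSum svc) / (2 * ε i) + B (ε i)) := by gcongr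
    _ = _ := by
      field_simp

end HeavyTraffic

end

end Routing

theorem mainTheorem2 (L : ℕ) [NeZero L] (svc : Fin L → PMF ℕ) (Smax Amax : ℕ)
    (hsvc_bdd : ∀ l, Routing.BoundedBy (svc l) Smax)
    (hsvc_pos : ∀ l, 0 < Routing.mean (svc l)) :
    -- JSQ has a steady state
    (∀ (ε : ℝ) (arr : PMF ℕ), Routing.IsArrivalLaw svc Amax ε arr →
      ∃ π, Routing.IsSteadyState svc arr (Routing.JSQ L) π) ∧
    -- the upper bound for every positive `ε`
    (∃ B : ℝ → ℝ, Tendsto (fun ε => ε * B ε) (𝓝[>] 0) (𝓝 0) ∧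
      ∀ (ε : ℝ) (arr : PMF ℕ), Routing.IsArrivalLaw svc Amax ε arr →
        ∀ π, Routing.IsSteadyState svc arr (Routing.JSQ L) π →
          Routing.meanTotal π ≠ ∞ ∧
          (Routing.meanTotal π).toReal ≤
            (Routing.var arr + Routing.nuSqSum svc) / (2 * ε) + B ε) ∧
    -- the heavy-traffic limit
    (∀ {ι : Type*} (l : Filter ι) (ε : ι → ℝ) (arr : ι → PMF ℕ) (σSq : ℝ),
      Tendsto ε l (𝓝[>] 0) →
      (∀ᶠ i in l, Routing.IsArrivalLaw svc Amax (ε i) (arr i)) →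
      Tendsto (fun i => Routing.var (arr i)) l (𝓝 σSq) →
      -- the upper bound for JSQ, and the limit
      (∀ π : ι → PMF (Fin L → ℕ),
        (∀ᶠ i in l, Routing.IsSteadyState svc (arr i) (Routing.JSQ L) (π i)) →
          limsup (fun i => ENNReal.ofReal (ε i) * Routing.meanTotal (π i)) l ≤
            ENNReal.ofReal ((σSq + Routing.nuSqSum svc) / 2) ∧
          Tendsto (fun i => ENNReal.ofReal (ε i) * Routing.meanTotal (π i)) l
            (𝓝 (ENNReal.ofReal ((σSq + Routing.nuSqSum svc) / 2)))) ∧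
      -- no feasible policy does better
      (∀ (P : ι → Routing.Policy L) (π : ι → PMF (Fin L → ℕ)),
        (∀ᶠ i in l, Routing.IsSteadyState svc (arr i) (P i) (π i)) →
          ENNReal.ofReal ((σSq + Routing.nuSqSum svc) / 2) ≤
            liminf (fun i => ENNReal.ofReal (ε i) * Routing.meanTotal (π i)) l)) := by
  refine ⟨fun ε arr ha => ?_, Routing.exists_upper_bound_JSQ hsvc_bdd hsvc_pos Amax, ?_⟩
  · obtain ⟨μ₀, hμ₀, hμ⟩ := Routing.exists_pos_le_mean hsvc_pos
    have hL : (0 : ℝ) < L := zero_lt_one.trans_le Routing.card_pos_real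
    have hε := ha.pos
    exact Routing.exists_steadyState_JSQ hsvc_bdd ha (δ := min (ε / L) μ₀) (by positivity)
      (fun k => (min_le_right _ _).trans (hμ k))
      (by rw [mul_comm]; exact (le_div_iff₀ hL).1 (min_le_left _ _))
  · intro ι l ε arr σSq hε harr hσ
    refine ⟨fun π hπ => ?_, fun P π hπ => Routing.le_liminf_meanTotal hsvc_bdd hε harr hσ hπ⟩
    have hsup := Routing.limsup_meanTotal_JSQ_le hsvc_bdd hsvc_pos hε harr hσ hπ
    exact ⟨hsup, tendsto_of_le_liminf_of_limsup_le
      (Routing.le_liminf_meanTotal hsvc_bdd hε harr hσ hπ) hsup⟩
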